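/- Work over the field $\mathbb F_2$ with two elements and fix an integer $n\ge 0$. **Filtered face sets.** Let $\mathbf\Delta_{\mathcal F}^{[n]}$ be the category whose objects are the joins $\Delta=\Delta^{j_0}*\cdots*\Delta^{j_n}$ with $j_i\ge -1$ ($\Delta^{-1}=\emptyset$) and whose morphisms are the joins of injective order-preserving maps $\Delta^{j_i}\to\Delta^{k_i}$. A *filtered face set* is a contravariant functor $K$ from $\mathbf\Delta_{\mathcal F}^{[n]}$ to sets, a *filtered face map* is a natural transformation, and $K_+$ is the restriction of $K$ to the objects with $j_n\ge 0$. **Blow-up.** Let $N^*(-)$ denote normalized simplicial cochains with coefficients in $\mathbb F_2$ and let $c\Delta^j$ be the cone on $\Delta^j$. To each simplex $\sigma\in K_{(j_0,\dots,j_n)}$ with $j_n\ge 0$ associate the complex $\widetilde N^*_\sigma=N^*(c\Delta^{j_0})\otimes\cdots\otimes N^*(c\Delta^{j_{n-1}})\otimes N^*(\Delta^{j_n})$. An element $c\in\widetilde N^*(K)$ is a family $c_\sigma\in\widetilde N^*_\sigma$, $\sigma\in K_+$, compatible with all morphisms of $\mathbf\Delta_{\mathcal F}^{[n]}$ between objects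 with $j_n\ge0$; the differential $\delta$ is computed simplexwise. For $1\le \ell\le n$, the degree $\|c_\sigma\|_\ell$ is defined by restricting $c_\sigma$ to $N^*(c\Delta^{j_0})\otimes\cdots\otimes N^*(\Delta^{j_{n-\ell}}\times\{1\})\otimes\cdots\otimes N^*(\Delta^{j_n})$ (the base of the cone in position $n-\ell$) and taking the largest degree, in the factors of index $>n-\ell$, of the elements of the canonical basis that occur in this restriction; it is $-\infty$ if the restriction is zero or $\Delta^{j_{n-\ell}}=\emptyset$. Put $\|c\|_\ell=\sup_{\sigma}\|c_\sigma\|_\ell$. A *loose perversity* is a map $\bar p\colon\mathbb N\to\mathbb Z$ with $\bar p(0)=0$; loose perversities are ordered and added pointwise. Let $\widetilde N^*_{\bar p}(K)$ be the complex of those $c$ with $\|c\|_\ell\le\bar p(\ell)$ and $\|\delta c\|_\ell\le\bar p(\ell)$ for $1\le \ell\le n$. This gives a functor $\bar p\mapsto\widetilde N^*_{\bar p}(K)$ from the poset of loose perversities to cochain complexes (a *generalized perverse cochain complex*), contravariant in $K$. **Perverse $\mathcal E(2)$-algebras.** Let $\mathcal E(2)$ be the resolution of $\Sigma_2=\{1,\tau\}$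 with $\mathcal E(2)_i=\mathbb F_2\langle e_i,\tau_i\rangle$, $i\ge0$ (in cohomological degree $-i$), $\tau e_i=\tau_i$, $\tau\tau_i=e_i$, $de_i=d\tau_i=e_{i-1}+\tau_{i-1}$ for $i\geq 1$ and $de_0=d\tau_0=0$. A *perverse $\mathcal E(2)$-algebra structure* on a generalized perverse cochain complex $A^*_\bullet$ consists of cochain maps $\psi\colon\mathcal E(2)\otimes A^*_{\bar p}\otimes A^*_{\bar q}\to A^*_{\bar p+\bar q}$, natural in $\bar p$ and $\bar q$, with $\psi(\tau b\otimes x\otimes y)=\psi(b\otimes y\otimes x)$. Equivalently, with $x\cup_i y=\psi(e_i\otimes x\otimes y)$, it consists of natural products $\cup_i\colon A^r_{\bar p}\otimes A^s_{\bar q}\to A^{r+s-i}_{\bar p+\bar q}$, $i\ge 0$, such that $$\delta(x\cup_i y)=x\cup_{i-1}y+y\cup_{i-1}x+\delta x\cup_i y+x\cup_i\delta y\qquad(\cup_{-1}=0).$$ It is *nice* if for all homogeneous $x,x'$ one has $x\cup_{|x|}x=x$ and $x\cup_i x'=0$ for $i>\min(|x|,|x'|)$. (For $x\in A_{\bar p}$,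 the first equality means that both sides have the same image in $A_{\bar r}$ for every $\bar r\ge\bar p,\ 2\bar p$; for $\widetilde N^*_\bullet(K)$ it is an equality in $\widetilde N^*(K)$.) **Theorem.** For every filtered face set $K$ the generalized perverse cochain complex $\bar p\mapsto\widetilde N^*_{\bar p}(K)$ carries a structure of nice perverse $\mathcal E(2)$-algebra, and these structures can be chosen naturally in $K$: for every filtered face map $f\colon K\to K'$ the induced maps $f^*\colon\widetilde N^*_{\bar p}(K')\to\widetilde N^*_{\bar p}(K)$ satisfy $f^*\psi(b\otimes x\otimes y)=\psi(b\otimes f^*x\otimes f^*y)$. -/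

import Mathlib

open CategoryTheory Opposite
open scoped Simplicial TensorProduct

universe u

namespace PerverseBlowup

/-! ### Normalized cochains of a simplicial set over the field with two elements -/

/-- The normalized cochains `N^*(Y) = hom(N_*(Y), 𝔽₂)` of a simplicial set, all degrees together:
families of functions on the `d`-simplices that vanish on the images of the degeneracies.
(For the simplices to which this is applied, `N^d` vanishes for large `d`.) -/
def NCochain (Y : SSet.{0}) : Submodule (ZMod 2) ((d : ℕ) → Y _⦋d⦌ → ZMod 2) where
  carrier := {f | ∀ (d : ℕ) (j : Fin (d + 1)) (y : Y _⦋d⦌), f (d + 1) (Y.σ j y) = 0}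
  add_mem' := by
    intro f g hf hg d j y
    simp [hf d j y, hg d j y]
  zero_mem' := by
    intro d j y
    rfl
  smul_mem' := by
    intro r f hf d j y
    simp [hf d j y]

/-- The coboundary on families of functions: the sum over all faces. -/
def coboundaryFun (Y : SSet.{0}) (f : (d : ℕ) → Y _⦋d⦌ → ZMod 2) : (d : ℕ) → Y _⦋d⦌ → ZMod 2 :=
  fun d => match d with
    | 0 => fun _ => 0
    | d + 1 => fun y => ∑ i : Fin (d + 2), f d (Y.δ i y)

theorem coboundaryFun_mem (Y : SSet.{0}) {f : (d : ℕ) → Y _⦋d⦌ → ZMod 2} (hf : f ∈ NCochain Y) :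
    coboundaryFun Y f ∈ NCochain Y := by
  intro d j y
  have key : ∀ i : Fin (d + 2), i ≠ j.castSucc → i ≠ j.succ → f d (Y.δ i (Y.σ j y)) = 0 := by
    intro i h1 h2
    cases d with
    | zero =>
      exfalso
      fin_cases i <;> fin_cases j <;> simp_all
    | succ e =>
      rcases lt_or_gt_of_ne h1 with h | h
      · obtain ⟨j', rfl⟩ : ∃ j' : Fin (e + 1), j = j'.succ := by
          refine ⟨j.pred ?_, (Fin.succ_pred _ _).symm⟩
          rintro rfl
          simp at h
        obtain ⟨i', rfl⟩ : ∃ i' : Fin (e + 2), i = i'.castSucc := by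
          refine ⟨i.castPred ?_, (Fin.castSucc_castPred _ _).symm⟩
          rintro rfl
          exact absurd h (not_lt.2 (Fin.le_last _))
        have hle : i' ≤ j'.castSucc := by
          rw [Fin.lt_def] at h
          rw [Fin.le_def]
          simp at h ⊢
          omega
        have := ConcreteCategory.congr_hom (Y.δ_comp_σ_of_le hle) y
        simp only [CategoryTheory.comp_apply] at this
        rw [this]
        exact hf e j' _
      · have h3 : j.succ < i := by
          rw [Fin.lt_def] at h ⊢
          have : (i : ℕ) ≠ (j : ℕ) + 1 := fun hh => h2 (Fin.ext (by simpa using hh))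
          simp at h ⊢
          omega
        obtain ⟨i', rfl⟩ : ∃ i' : Fin (e + 2), i = i'.succ := by
          refine ⟨i.pred ?_, (Fin.succ_pred _ _).symm⟩
          rintro rfl
          simp at h
        obtain ⟨j', rfl⟩ : ∃ j' : Fin (e + 1), j = j'.castSucc := by
          refine ⟨j.castPred ?_, (Fin.castSucc_castPred _ _).symm⟩
          rintro rfl
          rw [Fin.lt_def] at h3
          have := i'.2
          simp at h3
          omega
        have hlt : j'.castSucc < i' := by
          rw [Fin.lt_def] at h3 ⊢
          simp at h3 ⊢
          omega
        have := ConcreteCategory.congr_hom (Y.δ_comp_σ_of_gt hlt) y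
        simp only [CategoryTheory.comp_apply] at this
        rw [this]
        exact hf e j' _
  have hne : j.castSucc ≠ j.succ := by
    intro h
    simpa using congrArg Fin.val h
  change ∑ i : Fin (d + 2), f d (Y.δ i (Y.σ j y)) = 0
  rw [← Finset.sum_subset (Finset.subset_univ {j.castSucc, j.succ})
    (fun i _ hi => key i (fun h => hi (by simp [h])) (fun h => hi (by simp [h]))),
    Finset.sum_pair hne]
  have e1 := ConcreteCategory.congr_hom (Y.δ_comp_σ_self (i := j)) y
  have e2 := ConcreteCategory.congr_hom (Y.δ_comp_σ_succ (i := j)) y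
  simp only [CategoryTheory.comp_apply] at e1 e2
  rw [e1, e2]
  exact CharTwo.add_self_eq_zero _

/-- The coboundary `δ` of `N^*(Y)`. -/
def NCochain.δ (Y : SSet.{0}) : NCochain Y →ₗ[ZMod 2] NCochain Y where
  toFun f := ⟨coboundaryFun Y f.1, coboundaryFun_mem Y f.2⟩
  map_add' f g := by
    ext d y
    cases d with
    | zero => simp [coboundaryFun]
    | succ d => simp [coboundaryFun, Finset.sum_add_distrib]
  map_smul' r f := by
    ext d y
    cases d with
    | zero => simp [coboundaryFun]
    | succ d => simp [coboundaryFun, Finset.mul_sum]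

theorem NCochain.δ_δ (Y : SSet.{0}) : NCochain.δ Y ∘ₗ NCochain.δ Y = 0 := by
  ext f d y
  match d with
  | 0 => rfl
  | 1 =>
    change ∑ i : Fin 2, coboundaryFun Y f.1 0 (Y.δ i y) = 0
    simp [coboundaryFun]
  | m + 2 =>
    change ∑ i : Fin (m + 3), ∑ j : Fin (m + 2), f.1 m (Y.δ j (Y.δ i y)) = 0
    rw [← Finset.sum_product']
    let P := Fin (m + 3) × Fin (m + 2)
    let S : Finset P := Finset.univ.filter fun ij => (ij.1 : ℕ) ≤ (ij.2 : ℕ)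
    rw [Finset.univ_product_univ, ← Finset.sum_add_sum_compl S]
    have : ∑ ij ∈ S, f.1 m (Y.δ ij.2 (Y.δ ij.1 y)) = ∑ ij ∈ Sᶜ, f.1 m (Y.δ ij.2 (Y.δ ij.1 y)) := by
      let φ : ∀ ij : P, ij ∈ S → P := fun ij hij =>
        (ij.2.succ,
          Fin.castLT ij.1 (lt_of_le_of_lt (Finset.mem_filter.mp hij).right (Fin.is_lt ij.2)))
      apply Finset.sum_bij φ
      · intro ij hij
        simp_rw [S, φ, Finset.compl_filter, Finset.mem_filter_univ, Fin.val_succ,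
          Fin.val_castLT] at hij ⊢
        omega
      · rintro ⟨i, j⟩ hij ⟨i', j'⟩ hij' h
        rw [Prod.mk_inj]
        refine ⟨?_, ?_⟩
        · have := congr_arg (fun x : P => (x.2 : ℕ)) h
          exact Fin.ext (by simpa [φ] using this)
        · have := congr_arg (fun x : P => (x.1 : ℕ)) h
          exact Fin.ext (by simpa [φ] using this)
      · rintro ⟨i', j'⟩ hij'
        simp_rw [S, Finset.compl_filter, Finset.mem_filter_univ, not_le] at hij'
        refine ⟨(Fin.castSucc j', i'.pred ?_), ?_, ?_⟩
        · intro h0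
          subst h0
          simp at hij'
        · simp [S]
          omega
        · simp [φ]
      · rintro ⟨i, j⟩ hij
        have hij' : i ≤ j.castSucc := by simpa [S, Fin.le_def] using hij
        have := ConcreteCategory.congr_hom (Y.δ_comp_δ'' hij') y
        simp only [CategoryTheory.comp_apply] at this
        simp only [φ]
        rw [this]
    rw [this]
    exact CharTwo.add_self_eq_zero _

/-- The map on normalized cochains induced by a map of simplicial sets. -/
def NCochain.map {Y Z : SSet.{0}} (φ : Y ⟶ Z) : NCochain Z →ₗ[ZMod 2] NCochain Y where
  toFun f := ⟨fun d y => f.1 d (φ.app (op ⦋d⦌) y), by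
    intro d j y
    have := ConcreteCategory.congr_hom (SimplicialObject.σ_naturality φ j) y
    simp only [CategoryTheory.comp_apply] at this
    change f.1 (d + 1) (φ.app (op ⦋d + 1⦌) (Y.σ j y)) = 0
    rw [this]
    exact f.2 d j _⟩
  map_add' f g := rfl
  map_smul' r f := rfl

theorem NCochain.δ_map {Y Z : SSet.{0}} (φ : Y ⟶ Z) :
    NCochain.δ Y ∘ₗ NCochain.map φ = NCochain.map φ ∘ₗ NCochain.δ Z := by
  ext f d y
  cases d with
  | zero => rfl
  | succ d =>
    change ∑ i : Fin (d + 2), f.1 d (φ.app (op ⦋d⦌) (Y.δ i y)) =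
      ∑ i : Fin (d + 2), f.1 d (Z.δ i (φ.app (op ⦋d + 1⦌) y))
    refine Finset.sum_congr rfl fun i _ => ?_
    have := ConcreteCategory.congr_hom (SimplicialObject.δ_naturality φ i) y
    simp only [CategoryTheory.comp_apply] at this
    rw [this]

/-- Evaluation of a normalized cochain on a simplex. -/
def NCochain.eval (Y : SSet.{0}) (y : Σ d : ℕ, Y _⦋d⦌) : NCochain Y →ₗ[ZMod 2] ZMod 2 where
  toFun f := f.1 y.1 y.2
  map_add' _ _ := rfl
  map_smul' _ _ := rfl

/-- The standard simplex with linearly ordered vertex set `V` (empty if `V` is empty). -/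
def simplex (V : Type) [LinearOrder V] : SSet.{0} where
  obj m := Fin (m.unop.len + 1) →o V
  map g := ↾fun x => x.comp g.unop.toOrderHom

/-- The simplicial map between standard simplices given by a monotone map of vertices. -/
def simplexMap {V W : Type} [LinearOrder V] [LinearOrder W] (φ : V →o W) :
    simplex V ⟶ simplex W where
  app _ := ↾fun x => φ.comp x

/-! ### Filtered simplices and filtered face sets -/

/-- A join `Δ^{j₀} * ⋯ * Δ^{jₙ}`, recorded by the numbers of vertices `card i = j_i + 1 ≥ 0`. -/
@[ext]
structure FilteredSimplex (n : ℕ) where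
  card : Fin (n + 1) → ℕ

/-- Morphisms are joins of injective order-preserving maps `Δ^{j_i} → Δ^{k_i}`. -/
instance (n : ℕ) : Category (FilteredSimplex n) where
  Hom a b := ∀ i, Fin (a.card i) ↪o Fin (b.card i)
  id a := fun i => RelEmbedding.refl _
  comp f g := fun i => (f i).trans (g i)

/-- The filtered simplices with `Δ^{jₙ} ≠ ∅`. -/
abbrev RegularSimplex (n : ℕ) : Type := {a : FilteredSimplex n // 0 < a.card (Fin.last n)}

/-- Filtered face sets (of formal dimension `n`) and filtered face maps. -/
abbrev FilteredFaceSet (n : ℕ) : Type (u + 1) := (FilteredSimplex n)ᵒᵖ ⥤ Type u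

/-! ### The local blow-up -/

/-- Ordered vertices of the `i`-th factor of the prism
`cΔ^{j₀} × ⋯ × cΔ^{jₙ₋₁} × Δ^{jₙ}`: for `i < n`, the vertices of `Δ^{j_i}` and the cone point,
written `⊤`; for `i = n`, only the vertices of `Δ^{jₙ}`. -/
abbrev Vertex {n : ℕ} (a : FilteredSimplex n) (i : Fin (n + 1)) : Type :=
  {v : WithTop (Fin (a.card i)) // i = Fin.last n → v ≠ ⊤}

/-- The map on vertices of the factors, which preserves the cone point. -/
def vertexMap {n : ℕ} {a b : FilteredSimplex n} (f : a ⟶ b) (i : Fin (n + 1)) :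
    Vertex a i →o Vertex b i where
  toFun v := ⟨v.1.map (f i), fun h => by simpa [WithTop.map_eq_top_iff] using v.2 h⟩
  monotone' _ _ h := WithTop.monotone_map_iff.2 (f i).monotone h

/-- The `i`-th factor of the blow-up of a filtered simplex, as a simplicial set. -/
abbrev factor {n : ℕ} (a : FilteredSimplex n) (i : Fin (n + 1)) : SSet.{0} := simplex (Vertex a i)

/-- `N^*(cΔ^{j₀}) ⊗ ⋯ ⊗ N^*(cΔ^{jₙ₋₁}) ⊗ N^*(Δ^{jₙ})`, all degrees together. -/
abbrev LocalBlowup {n : ℕ} (a : FilteredSimplex n) : Type :=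
  ⨂[ZMod 2] i, NCochain (factor a i)

/-- `id ⊗ ⋯ ⊗ δ ⊗ ⋯ ⊗ id`, with `δ` in position `i`. -/
noncomputable def localδAt {n : ℕ} (a : FilteredSimplex n) (i : Fin (n + 1)) :
    LocalBlowup a →ₗ[ZMod 2] LocalBlowup a :=
  PiTensorProduct.map (Function.update (β := fun j => NCochain (factor a j) →ₗ[ZMod 2]
    NCochain (factor a j)) (fun _ => LinearMap.id) i (NCochain.δ (factor a i)))

/-- The differential of the tensor product. -/
noncomputable def localδ {n : ℕ} (a : FilteredSimplex n) : LocalBlowup a →ₗ[ZMod 2] LocalBlowup a :=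
  ∑ i, localδAt a i

/-- The restriction of cochains along a face map of filtered simplices. -/
noncomputable def pullback {n : ℕ} {a b : FilteredSimplex n} (f : a ⟶ b) :
    LocalBlowup b →ₗ[ZMod 2] LocalBlowup a :=
  PiTensorProduct.map fun i => NCochain.map (simplexMap (vertexMap f i))

/-- The products of simplices of the factors. The nondegenerate ones index the canonical basis of
the tensor product. -/
abbrev Cell {n : ℕ} (a : FilteredSimplex n) : Type :=
  ∀ i : Fin (n + 1), Σ d : ℕ, (factor a i) _⦋d⦌

/-- The coefficient of a cochain on the canonical basis element dual to the cell `y`; on pure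
tensors it is `x₀ ⊗ ⋯ ⊗ xₙ ↦ x₀(y₀) ⋯ xₙ(yₙ)`. It is zero if some `y_i` is degenerate. -/
noncomputable def coeff {n : ℕ} {a : FilteredSimplex n} (y : Cell a) :
    LocalBlowup a →ₗ[ZMod 2] ZMod 2 :=
  PiTensorProduct.lift ((MultilinearMap.mkPiAlgebra (ZMod 2) (Fin (n + 1)) (ZMod 2)).compLinearMap
    fun i => NCochain.eval (factor a i) (y i))

/-- Elements of total degree `d` of the tensor product. -/
def IsHomogeneous {n : ℕ} {a : FilteredSimplex n} (d : ℤ) (c : LocalBlowup a) : Prop :=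
  ∀ y : Cell a, coeff y c ≠ 0 → ∑ i, ((y i).1 : ℤ) = d

/-- The `ℓ`-perverse degree of a local cochain. With `i = n - ℓ`, the supremum runs over the basis
elements that occur in the restriction of `c` to
`cΔ^{j₀} × ⋯ × (Δ^{j_i} × {1}) × ⋯ × Δ^{jₙ}` (the `i`-th simplex avoids the cone point), and the
value is the degree of the part of the basis element in the factors after the `i`-th.
It is `⊥ = -∞` if the restriction is zero or `Δ^{j_i} = ∅`. -/
noncomputable def localPerverseDegree {n : ℕ} {a : FilteredSimplex n} (ℓ : ℕ) (c : LocalBlowup a) :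
    EReal :=
  ⨆ (i : Fin (n + 1)) (_ : (i : ℕ) + ℓ = n) (y : Cell a)
    (_ : ∀ k, ((show Fin ((y i).1 + 1) →o Vertex a i from (y i).2) k).1 ≠ ⊤)
    (_ : coeff y c ≠ 0), ((∑ j ∈ Finset.Ioi i, (y j).1 : ℕ) : EReal)

theorem localδAt_comp_self {n : ℕ} (a : FilteredSimplex n) (i : Fin (n + 1)) :
    localδAt a i ∘ₗ localδAt a i = 0 := by
  refine PiTensorProduct.ext (MultilinearMap.ext fun x => ?_)
  simp only [localδAt, LinearMap.compMultilinearMap_apply, LinearMap.comp_apply,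
    PiTensorProduct.map_tprod, LinearMap.zero_apply]
  refine MultilinearMap.map_coord_zero _ i ?_
  simpa using LinearMap.congr_fun (NCochain.δ_δ (factor a i)) (x i)

theorem localδAt_comm {n : ℕ} (a : FilteredSimplex n) (i j : Fin (n + 1)) :
    localδAt a i ∘ₗ localδAt a j = localδAt a j ∘ₗ localδAt a i := by
  rw [localδAt, localδAt, ← PiTensorProduct.map_comp, ← PiTensorProduct.map_comp]
  congr 1
  funext k
  by_cases hi : k = i <;> by_cases hj : k = j
  · subst hi; subst hj; rfl
  · subst hi; simp [Function.update_of_ne hj]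
  · subst hj; simp [Function.update_of_ne hi]
  · simp [Function.update_of_ne hi, Function.update_of_ne hj]

theorem localδ_localδ {n : ℕ} {a : FilteredSimplex n} (c : LocalBlowup a) :
    localδ a (localδ a c) = 0 := by
  simp only [localδ, LinearMap.sum_apply, map_sum]
  rw [← Finset.sum_product']
  refine Finset.sum_involution (fun p _ => p.swap) ?_ ?_ (fun _ _ => by simp) (fun _ _ => by simp)
  · rintro ⟨i, j⟩ _
    have := LinearMap.congr_fun (localδAt_comm a i j) c
    simp only [LinearMap.comp_apply] at this
    simp only [Prod.swap_prod_mk]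
    rw [this, ← two_smul (ZMod 2), show (2 : ZMod 2) = 0 from rfl, zero_smul]
  · rintro ⟨i, j⟩ _ hne h
    obtain rfl : j = i := congrArg Prod.fst h
    exact hne (LinearMap.congr_fun (localδAt_comp_self a j) c)

theorem localδ_pullback {n : ℕ} {a b : FilteredSimplex n} (f : a ⟶ b) (c : LocalBlowup b) :
    localδ a (pullback f c) = pullback f (localδ b c) := by
  simp only [localδ, LinearMap.sum_apply, map_sum]
  refine Finset.sum_congr rfl fun i _ => ?_
  suffices h : localδAt a i ∘ₗ pullback f = pullback f ∘ₗ localδAt b i from LinearMap.congr_fun h c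
  rw [localδAt, localδAt, pullback, ← PiTensorProduct.map_comp, ← PiTensorProduct.map_comp]
  congr 1
  funext k
  by_cases hi : k = i
  · subst hi
    simpa using NCochain.δ_map (simplexMap (vertexMap f k))
  · simp [Function.update_of_ne hi]

theorem IsHomogeneous.δ {n : ℕ} {a : FilteredSimplex n} {d : ℤ} {c : LocalBlowup a}
    (hc : IsHomogeneous d c) : IsHomogeneous (d + 1) (localδ a c) := by
  intro y hy
  simp only [localδ, LinearMap.sum_apply, map_sum] at hy
  obtain ⟨i, -, hi⟩ := Finset.exists_ne_zero_of_sum_ne_zero hy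
  rcases hyi : y i with ⟨m, z⟩
  cases m with
  | zero =>
    exfalso
    apply hi
    suffices h : coeff y ∘ₗ localδAt a i = 0 from LinearMap.congr_fun h c
    refine PiTensorProduct.ext (MultilinearMap.ext fun x => ?_)
    simp only [coeff, localδAt, LinearMap.compMultilinearMap_apply, LinearMap.comp_apply,
      PiTensorProduct.map_tprod, PiTensorProduct.lift.tprod, LinearMap.zero_apply,
      MultilinearMap.compLinearMap_apply, MultilinearMap.mkPiAlgebra_apply]
    refine Finset.prod_eq_zero (Finset.mem_univ i) ?_
    rw [hyi]
    simp [NCochain.eval, NCochain.δ, coboundaryFun]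
  | succ m =>
    have h : coeff y ∘ₗ localδAt a i =
        ∑ k : Fin (m + 2), coeff (Function.update y i ⟨m, (factor a i).δ k z⟩) := by
      refine PiTensorProduct.ext (MultilinearMap.ext fun x => ?_)
      simp only [coeff, localδAt, LinearMap.compMultilinearMap_apply, LinearMap.comp_apply,
        PiTensorProduct.map_tprod, PiTensorProduct.lift.tprod, LinearMap.sum_apply,
        MultilinearMap.compLinearMap_apply, MultilinearMap.mkPiAlgebra_apply]
      rw [← Finset.mul_prod_erase _ _ (Finset.mem_univ i), Function.update_self, hyi]
      have e1 : NCochain.eval (factor a i) ⟨m + 1, z⟩ (NCochain.δ (factor a i) (x i)) =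
          ∑ k : Fin (m + 2), NCochain.eval (factor a i) ⟨m, (factor a i).δ k z⟩ (x i) := rfl
      rw [e1, Finset.sum_mul]
      refine Finset.sum_congr rfl fun k _ => ?_
      rw [← Finset.mul_prod_erase _ _ (Finset.mem_univ i), Function.update_self]
      congr 1
      refine Finset.prod_congr rfl fun l hl => ?_
      rw [Function.update_of_ne (Finset.ne_of_mem_erase hl),
        Function.update_of_ne (Finset.ne_of_mem_erase hl)]
      rfl
    have h' := LinearMap.congr_fun h c
    rw [LinearMap.comp_apply, LinearMap.sum_apply] at h'
    rw [h'] at hi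
    obtain ⟨k, -, hk⟩ := Finset.exists_ne_zero_of_sum_ne_zero hi
    have h2 := hc _ hk
    rw [← Finset.add_sum_erase _ _ (Finset.mem_univ i), Function.update_self] at h2
    rw [← Finset.add_sum_erase _ _ (Finset.mem_univ i), hyi, ← h2]
    have : ∑ l ∈ Finset.univ.erase i,
        ((Function.update y i ⟨m, (factor a i).δ k z⟩ l).1 : ℤ) =
        ∑ l ∈ Finset.univ.erase i, ((y l).1 : ℤ) :=
      Finset.sum_congr rfl fun l hl => by
        rw [Function.update_of_ne (Finset.ne_of_mem_erase hl)]
    rw [this]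
    push_cast
    ring

/-! ### Global sections, perverse degree and intersection cochains -/

/-- The families of local cochains, indexed by the simplices `σ` of `K₊`, that are compatible with
all face maps, as a submodule of all families. -/
def globalSections {n : ℕ} (K : FilteredFaceSet.{u} n) :
    Submodule (ZMod 2) ((a : RegularSimplex n) → K.obj (op a.1) → LocalBlowup a.1) where
  carrier := {c | ∀ (a b : RegularSimplex n) (f : a.1 ⟶ b.1) (σ : K.obj (op b.1)),
    c a (K.map f.op σ) = pullback f (c b σ)}
  add_mem' := by
    intro c c' hc hc' a b f σ
    simp [hc a b f σ, hc' a b f σ]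
  zero_mem' := by
    intro a b f σ
    simp
  smul_mem' := by
    intro r c hc a b f σ
    simp [hc a b f σ]

/-- Global sections on `K`: functions that assign to each simplex `σ` of `K₊` a local cochain,
compatibly with all face maps. -/
def GlobalSection {n : ℕ} (K : FilteredFaceSet.{u} n) : Type u := globalSections K

noncomputable instance {n : ℕ} (K : FilteredFaceSet.{u} n) : AddCommGroup (GlobalSection K) :=
  @Module.addCommMonoidToAddCommGroup (ZMod 2) (globalSections K) _ _ _

noncomputable instance {n : ℕ} (K : FilteredFaceSet.{u} n) : Module (ZMod 2) (GlobalSection K) :=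
  inferInstanceAs (Module (ZMod 2) (globalSections K))

/-- The value of a global section on a simplex, as a linear map. -/
def GlobalSection.val {n : ℕ} {K : FilteredFaceSet.{u} n} (a : RegularSimplex n)
    (σ : K.obj (op a.1)) : GlobalSection K →ₗ[ZMod 2] LocalBlowup a.1 where
  toFun c := c.1 a σ
  map_add' _ _ := rfl
  map_smul' _ _ := rfl

theorem GlobalSection.ext {n : ℕ} {K : FilteredFaceSet.{u} n} {c c' : GlobalSection K}
    (h : ∀ a σ, c.val a σ = c'.val a σ) : c = c' :=
  Subtype.ext (funext fun a => funext fun σ => h a σ)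

theorem GlobalSection.val_map {n : ℕ} {K : FilteredFaceSet.{u} n} (c : GlobalSection K)
    {a b : RegularSimplex n} (f : a.1 ⟶ b.1) (σ : K.obj (op b.1)) :
    c.val a (K.map f.op σ) = pullback f (c.val b σ) :=
  c.2 a b f σ

/-- The differential of global sections, computed simplexwise. -/
noncomputable def sectionδ {n : ℕ} (K : FilteredFaceSet.{u} n) :
    GlobalSection K →ₗ[ZMod 2] GlobalSection K where
  toFun c := ⟨fun a σ => localδ a.1 (c.val a σ), fun a b f σ => by
    beta_reduce
    rw [c.val_map f, localδ_pullback]⟩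
  map_add' c c' := GlobalSection.ext fun a σ => by
    change localδ a.1 ((c + c').val a σ) = localδ a.1 (c.val a σ) + localδ a.1 (c'.val a σ)
    rw [map_add, map_add]
  map_smul' r c := GlobalSection.ext fun a σ => by
    change localδ a.1 ((r • c).val a σ) = r • localδ a.1 (c.val a σ)
    rw [map_smul, map_smul]

/-- The map on global sections induced by a filtered face map: `(f^* c)_σ = c_{f(σ)}`. -/
noncomputable def sectionMap {n : ℕ} {K K' : FilteredFaceSet.{u} n} (f : K ⟶ K') :
    GlobalSection K' →ₗ[ZMod 2] GlobalSection K where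
  toFun c := ⟨fun a σ => c.val a (f.app (op a.1) σ), fun a b g σ => by
    beta_reduce
    rw [← c.val_map g, ← CategoryTheory.comp_apply, f.naturality, CategoryTheory.comp_apply]⟩
  map_add' _ _ := rfl
  map_smul' _ _ := rfl

/-- The `ℓ`-perverse degree of a global section. -/
noncomputable def perverseDegree {n : ℕ} {K : FilteredFaceSet.{u} n} (ℓ : ℕ)
    (c : GlobalSection K) : EReal :=
  ⨆ (a : RegularSimplex n) (σ : K.obj (op a.1)), localPerverseDegree ℓ (c.val a σ)

/-- Loose perversities, ordered pointwise. -/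
abbrev LoosePerversity : Type := {p : ℕ → ℤ // p 0 = 0}

instance : Add LoosePerversity :=
  ⟨fun p q => ⟨fun i => p.1 i + q.1 i, by simp [p.2, q.2]⟩⟩

/-- `c` is `p`-admissible: `‖c‖_ℓ ≤ p(ℓ)` for `ℓ = 1, …, n`. -/
def IsAdmissible {n : ℕ} {K : FilteredFaceSet.{u} n} (p : LoosePerversity)
    (c : GlobalSection K) : Prop :=
  ∀ ℓ : ℕ, 1 ≤ ℓ → ℓ ≤ n → perverseDegree ℓ c ≤ (((p.1 ℓ : ℤ) : ℝ) : EReal)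

theorem isAdmissible_iff {n : ℕ} {K : FilteredFaceSet.{u} n} (p : LoosePerversity)
    (c : GlobalSection K) : IsAdmissible p c ↔
      ∀ ℓ : ℕ, 1 ≤ ℓ → ℓ ≤ n → ∀ (a : RegularSimplex n) (σ : K.obj (op a.1)) (i : Fin (n + 1)),
        (i : ℕ) + ℓ = n → ∀ y : Cell a.1,
        (∀ k, ((show Fin ((y i).1 + 1) →o Vertex a.1 i from (y i).2) k).1 ≠ ⊤) →
        coeff y (c.val a σ) ≠ 0 →
        ((∑ j ∈ Finset.Ioi i, (y j).1 : ℕ) : EReal) ≤ (((p.1 ℓ : ℤ) : ℝ) : EReal) := by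
  simp only [IsAdmissible, perverseDegree, localPerverseDegree, iSup_le_iff]

theorem IsAdmissible.zero {n : ℕ} {K : FilteredFaceSet.{u} n} (p : LoosePerversity) :
    IsAdmissible p (0 : GlobalSection K) := by
  rw [isAdmissible_iff]
  intro ℓ _ _ a σ i _ y _ h
  exact absurd (by simp) h

theorem IsAdmissible.add {n : ℕ} {K : FilteredFaceSet.{u} n} {p : LoosePerversity}
    {c c' : GlobalSection K} (hc : IsAdmissible p c) (hc' : IsAdmissible p c') :
    IsAdmissible p (c + c') := by
  rw [isAdmissible_iff] at *
  intro ℓ h1 h2 a σ i hi y hy h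
  by_cases h0 : coeff y (c.val a σ) = 0
  · refine hc' ℓ h1 h2 a σ i hi y hy fun h0' => h ?_
    simp [h0, h0']
  · exact hc ℓ h1 h2 a σ i hi y hy h0

theorem IsAdmissible.smul {n : ℕ} {K : FilteredFaceSet.{u} n} {p : LoosePerversity}
    {c : GlobalSection K} (r : ZMod 2) (hc : IsAdmissible p c) : IsAdmissible p (r • c) := by
  rw [isAdmissible_iff] at *
  intro ℓ h1 h2 a σ i hi y hy h
  refine hc ℓ h1 h2 a σ i hi y hy fun h0 => h ?_
  simp [h0]

theorem IsAdmissible.mono {n : ℕ} {K : FilteredFaceSet.{u} n} {p q : LoosePerversity} (h : p ≤ q)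
    {c : GlobalSection K} (hc : IsAdmissible p c) : IsAdmissible q c := fun ℓ h1 h2 =>
  (hc ℓ h1 h2).trans (by exact_mod_cast (show p.1 ℓ ≤ q.1 ℓ from h ℓ))

theorem IsAdmissible.map {n : ℕ} {K K' : FilteredFaceSet.{u} n} {p : LoosePerversity} (f : K ⟶ K')
    {c : GlobalSection K'} (hc : IsAdmissible p c) : IsAdmissible p (sectionMap f c) := by
  rw [isAdmissible_iff] at *
  intro ℓ h1 h2 a σ
  exact hc ℓ h1 h2 a (f.app (op a.1) σ)

/-- `Ñ^d_p(K)`: the global sections of degree `d` such that `c` and `δ c` are `p`-admissible. -/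
def intersectionCochain {n : ℕ} (K : FilteredFaceSet.{u} n) (p : LoosePerversity) (d : ℤ) :
    Submodule (ZMod 2) (GlobalSection K) where
  carrier := {c | (∀ a σ, IsHomogeneous d (c.val a σ)) ∧ IsAdmissible p c ∧
    IsAdmissible p (sectionδ K c)}
  add_mem' := by
    rintro c c' ⟨h1, h2, h3⟩ ⟨h1', h2', h3'⟩
    refine ⟨fun a σ y hy => ?_, h2.add h2', by rw [map_add]; exact h3.add h3'⟩
    by_cases h0 : coeff y (c.val a σ) = 0
    · refine h1' a σ y fun h0' => hy ?_
      simp [h0, h0']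
    · exact h1 a σ y h0
  zero_mem' := by
    refine ⟨fun a σ y hy => absurd (by simp) hy, .zero p, ?_⟩
    rw [map_zero]
    exact .zero p
  smul_mem' := by
    rintro r c ⟨h1, h2, h3⟩
    refine ⟨fun a σ y hy => h1 a σ y fun h0 => hy ?_, h2.smul r, by rw [map_smul]; exact h3.smul r⟩
    simp [h0]

theorem sectionδ_sectionδ {n : ℕ} {K : FilteredFaceSet.{u} n} (c : GlobalSection K) :
    sectionδ K (sectionδ K c) = 0 := by
  exact GlobalSection.ext fun a σ => localδ_localδ _

theorem sectionδ_mem {n : ℕ} {K : FilteredFaceSet.{u} n} {p : LoosePerversity} {d e : ℤ}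
    (h : d + 1 = e) {c : GlobalSection K} (hc : c ∈ intersectionCochain K p d) :
    sectionδ K c ∈ intersectionCochain K p e := by
  subst h
  refine ⟨fun a σ => (hc.1 a σ).δ, hc.2.2, ?_⟩
  rw [sectionδ_sectionδ]
  exact .zero p

theorem sectionMap_mem {n : ℕ} {K K' : FilteredFaceSet.{u} n} (f : K ⟶ K') {p : LoosePerversity}
    {d : ℤ} {c : GlobalSection K'} (hc : c ∈ intersectionCochain K' p d) :
    sectionMap f c ∈ intersectionCochain K p d :=
  ⟨fun a σ => hc.1 a (f.app (op a.1) σ), hc.2.1.map f, hc.2.2.map f⟩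

theorem intersectionCochain_mono {n : ℕ} {K : FilteredFaceSet.{u} n} {p q : LoosePerversity}
    (h : p ≤ q) (d : ℤ) : intersectionCochain K p d ≤ intersectionCochain K q d :=
  fun _ hc => ⟨hc.1, hc.2.1.mono h, hc.2.2.mono h⟩

/-- The differential `Ñ^d_p(K) → Ñ^{d+1}_p(K)`. -/
noncomputable def intersectionδ {n : ℕ} (K : FilteredFaceSet.{u} n) (p : LoosePerversity) {d e : ℤ}
    (h : d + 1 = e) : intersectionCochain K p d →ₗ[ZMod 2] intersectionCochain K p e :=
  (sectionδ K).restrict fun _ hc => sectionδ_mem h hc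

theorem intersectionδ_intersectionδ {n : ℕ} (K : FilteredFaceSet.{u} n) (p : LoosePerversity)
    {d e f : ℤ} (h : d + 1 = e) (h' : e + 1 = f) :
    intersectionδ K p h' ∘ₗ intersectionδ K p h = 0 :=
  LinearMap.ext fun c => Subtype.ext (sectionδ_sectionδ c.1)

/-- The cochain complex `Ñ^*_p(K)`. -/
noncomputable def intersectionComplex {n : ℕ} (K : FilteredFaceSet.{u} n) (p : LoosePerversity) :
    CochainComplex (ModuleCat.{u} (ZMod 2)) ℤ where
  X d := ModuleCat.of (ZMod 2) (intersectionCochain K p d)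
  d i j := if h : i + 1 = j then ModuleCat.ofHom (intersectionδ K p h) else 0
  shape i j h := dif_neg h
  d_comp_d' i j k hij hjk := by
    have hij' : i + 1 = j := hij
    have hjk' : j + 1 = k := hjk
    rw [dif_pos hij', dif_pos hjk', ← ModuleCat.ofHom_comp, intersectionδ_intersectionδ]
    rfl

/-- A generalized perverse cochain complex over `𝔽₂`: a functor from the poset of loose
perversities to cochain complexes. -/
abbrev GeneralizedPerverseComplex : Type (u + 1) :=
  LoosePerversity ⥤ CochainComplex (ModuleCat.{u} (ZMod 2)) ℤ

/-- The generalized perverse cochain complex `p ↦ Ñ^*_p(K)`; the transition maps are the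
inclusions. -/
noncomputable def blowup {n : ℕ} (K : FilteredFaceSet.{u} n) : GeneralizedPerverseComplex.{u} where
  obj p := intersectionComplex K p
  map {p q} h :=
    { f := fun d => ModuleCat.ofHom (Submodule.inclusion (intersectionCochain_mono (K := K) (leOfHom h) d))
      comm' := by
        intro i j hij
        have hij' : i + 1 = j := hij
        simp only [intersectionComplex, dif_pos hij']
        rfl }
  map_id p := rfl
  map_comp _ _ := rfl

/-- The map `Ñ^*_•(K') → Ñ^*_•(K)` induced by a filtered face map `K → K'`. -/
noncomputable def blowupMap {n : ℕ} {K K' : FilteredFaceSet.{u} n} (f : K ⟶ K') :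
    blowup K' ⟶ blowup K where
  app p :=
    { f := fun d => ModuleCat.ofHom ((sectionMap f).restrict fun _ hc => sectionMap_mem f hc)
      comm' := by
        intro i j hij
        have hij' : i + 1 = j := hij
        simp only [blowup, intersectionComplex, dif_pos hij']
        rfl }
  naturality _ _ _ := rfl

/-! ### Perverse `E(2)`-algebras -/

/-- Each component `E(2)_i`, `i ≥ 0`, of the normalized homogeneous bar resolution of `Σ₂`:
the `𝔽₂`-vector space on the two elements `e_i`, `τ_i`, identified with the elements of `Σ₂`.
The group acts by left multiplication. -/
abbrev E2 : Type := MonoidAlgebra (ZMod 2) (Equiv.Perm (Fin 2))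

/-- The generator `e_i`. -/
noncomputable def E2.e : E2 := MonoidAlgebra.single 1 1

/-- The generator `τ_i`. -/
noncomputable def E2.τ : E2 := MonoidAlgebra.single (Equiv.swap 0 1) 1

/-- The differential `E(2)_{i+1} → E(2)_i`, `d e_{i+1} = d τ_{i+1} = e_i + τ_i`. -/
noncomputable def E2.d : E2 →ₗ[ZMod 2] E2 := LinearMap.mulLeft (ZMod 2) (E2.e + E2.τ)

theorem E2.d_e : E2.d E2.e = E2.e + E2.τ := by
  simp [E2.d, E2.e, E2.τ, add_mul, MonoidAlgebra.single_mul_single]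

theorem E2.d_τ : E2.d E2.τ = E2.e + E2.τ := by
  simp [E2.d, E2.e, E2.τ, add_mul, MonoidAlgebra.single_mul_single, add_comm]

/-- A perverse `E(2)`-algebra structure on a generalized perverse cochain complex `A`: a cochain
map `ψ : E(2) ⊗ A_p ⊗ A_q → A_{p+q}`, natural in `p` and `q`, and `Σ₂`-equivariant. It is given by
its trilinear components `E(2)_i ⊗ A_p^s ⊗ A_q^t → A_r^m` with `r = p + q` and `m = s + t - i`
(`E(2)_i` sits in cohomological degree `-i`). -/
structure PerverseE2Algebra (A : GeneralizedPerverseComplex.{u}) where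
  /-- The components of the structure map. -/
  ψ {p q r : LoosePerversity} (hr : p + q = r) (i : ℕ) {s t m : ℤ} (hm : m + i = s + t) :
    E2 →ₗ[ZMod 2] (A.obj p).X s →ₗ[ZMod 2] (A.obj q).X t →ₗ[ZMod 2] (A.obj r).X m
  /-- Naturality in the perversities. -/
  natural {p q r p' q' r' : LoosePerversity} (hr : p + q = r) (hr' : p' + q' = r')
    (hp : p ≤ p') (hq : q ≤ q') (h : r ≤ r') (i : ℕ) {s t m : ℤ} (hm : m + i = s + t)
    (b : E2) (x : (A.obj p).X s) (y : (A.obj q).X t) :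
    (A.map (homOfLE h)).f m (ψ hr i hm b x y) =
      ψ hr' i hm b ((A.map (homOfLE hp)).f s x) ((A.map (homOfLE hq)).f t y)
  /-- Equivariance: `τ` exchanges the two arguments. -/
  equivariant {p q r : LoosePerversity} (hr : p + q = r) (hr' : q + p = r) (i : ℕ) {s t m : ℤ}
    (hm : m + i = s + t) (hm' : m + i = t + s)
    (b : E2) (x : (A.obj p).X s) (y : (A.obj q).X t) :
    ψ hr i hm (E2.τ * b) x y = ψ hr' i hm' b y x
  /-- `ψ` commutes with the differentials, for `E(2)`-degree zero. -/
  d_zero {p q r : LoosePerversity} (hr : p + q = r) {s t m s' t' m' : ℤ}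
    (hs : s + 1 = s') (ht : t + 1 = t') (hm' : m + 1 = m') (hm : m + (0 : ℕ) = s + t)
    (b : E2) (x : (A.obj p).X s) (y : (A.obj q).X t) :
    (A.obj r).d m m' (ψ hr 0 hm b x y) =
      ψ hr 0 (by omega) b ((A.obj p).d s s' x) y + ψ hr 0 (by omega) b x ((A.obj q).d t t' y)
  /-- `ψ` commutes with the differentials, for positive `E(2)`-degree. -/
  d_succ {p q r : LoosePerversity} (hr : p + q = r) (i : ℕ) {s t m s' t' m' : ℤ}
    (hs : s + 1 = s') (ht : t + 1 = t') (hm' : m + 1 = m') (hm : m + (i + 1 : ℕ) = s + t)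
    (b : E2) (x : (A.obj p).X s) (y : (A.obj q).X t) :
    (A.obj r).d m m' (ψ hr (i + 1) hm b x y) =
      ψ hr i (by omega) (E2.d b) x y + ψ hr (i + 1) (by omega) b ((A.obj p).d s s' x) y +
        ψ hr (i + 1) (by omega) b x ((A.obj q).d t t' y)

/-- The perverse `cup_i`-product `x ∪_i y = ψ(e_i ⊗ x ⊗ y)`. -/
noncomputable def PerverseE2Algebra.cup {A : GeneralizedPerverseComplex.{u}}
    (S : PerverseE2Algebra A) {p q r : LoosePerversity} (hr : p + q = r) (i : ℕ) {s t m : ℤ}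
    (hm : m + i = s + t) (x : (A.obj p).X s) (y : (A.obj q).X t) : (A.obj r).X m :=
  S.ψ hr i hm E2.e x y

/-- Nice perverse `E(2)`-algebras: `x ∪_{|x|} x = x`, and `x ∪_i x' = 0` for `i > min(|x|, |x'|)`.
For `x` of perversity `p`, the product `x ∪_{|x|} x` has perversity `p + p`; the two elements are
compared in every `A_r` to which both map. -/
structure PerverseE2Algebra.IsNice {A : GeneralizedPerverseComplex.{u}}
    (S : PerverseE2Algebra A) : Prop where
  cup_self {p r : LoosePerversity} (hp : p ≤ r) (hpp : p + p ≤ r) (d : ℕ)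
    (x : (A.obj p).X (d : ℤ)) :
    (A.map (homOfLE hpp)).f (d : ℤ) (S.cup rfl d rfl x x) = (A.map (homOfLE hp)).f (d : ℤ) x
  cup_eq_zero {p q r : LoosePerversity} (hr : p + q = r) (i : ℕ) {s t m : ℤ} (hm : m + i = s + t)
    (hi : min s t < i) (x : (A.obj p).X s) (y : (A.obj q).X t) : S.cup hr i hm x y = 0

end PerverseBlowup

/-! The structure is built simplex by simplex from Steenrod's cup-`i` products.

On one simplex, the value of `x ∪_i y` on a list of vertices is the sum of `x(u) y(w)` over all ways
to deal the list to two alternating speakers with `i + 1` vertices given to both. The coboundary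
formula is an induction on the list (`removalSum_splitSum_succ`). Counting shared vertices from zero
keeps this induction uniform: with none shared the second speaker gets the empty list, where
cochains are set to be zero, so this case is `∪_{-1} = 0`.

On a tensor product of cochain complexes, `E(2)` acts through its iterated diagonal `e_i ↦ ∑ e_{j₀}
⊗ τ^{j₀} e_{j₁} ⊗ τ^{j₀+j₁} e_{j₂} ⊗ ⋯`, summed over `j₀ + ⋯ + jₙ = i`. In the coboundary of such a
product, differentiating in factor `k` leaves two extra terms with `j_k` lowered by one; they differ
in whether factor `k` is exchanged. Reindexed by the lowered tuple, these terms have an additional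
exchange in all factors `> k`, respectively `≥ k`. Their sum over `k` telescopes to the product with
no additional exchange plus the one exchanged everywhere, that is to `x ∪_{i-1} y + y ∪_{i-1} x`
(`sum_cupDefect_succ`).

Everything else follows from the shape of the contributing faces. If `x(u) y(w)` occurs in the value
on a cell `z`, then in each factor `u_k` and `w_k` are faces of `z_k` with `dim u_k + dim w_k = dim
z_k + j_k` and `j_k ≤ dim u_k, dim w_k` (`exists_of_coeff_localCup_ne_zero`). Faces of a simplex
that avoids the cone point avoid it too, and `dim z_k ≤ dim u_k + dim w_k`, so perverse degrees are
subadditive (`IsAdmissible.cup`). The lower bounds give `i ≤ min(|x|, |y|)`. If `i = |x|` and `y =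
x` they force `u_k`, `w_k` and `z_k` all to have dimension `j_k`, leaving the square of `x(z)`,
which is `x(z)` in `𝔽₂`. Dealing out vertices commutes with maps of vertices, hence compatibility
with faces and naturality in `K`. -/

namespace PerverseBlowup

/-! ### Cup-`i` products of functions on lists -/

section Lists

variable {V W : Type}

/-- The ways to distribute the entries of a list on two speakers: the first one starts, every entry
goes to the current speaker, and `n` of the entries go to both speakers, which then change roles. -/
def splits (n : ℕ) (l : List V) : List (List V × List V) :=
  match n, l with
  | 0, [] => [([], [])]
  | _ + 1, [] => []
  | 0, v :: l => (splits 0 l).map fun p => (v :: p.1, p.2)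
  | n + 1, v :: l => ((splits (n + 1) l).map fun p => (v :: p.1, p.2)) ++
      (splits n l).map fun p => (v :: p.2, v :: p.1)

/-- The sum of `x(u) y(w)` over all distributions `(u, w)` of a list with `n` common entries. -/
def splitSum (n : ℕ) (x y : List V → ZMod 2) (l : List V) : ZMod 2 :=
  ((splits n l).map fun p => x p.1 * y p.2).sum

theorem splitSum_zero_nil (x y : List V → ZMod 2) : splitSum 0 x y [] = x [] * y [] := by
  simp [splitSum, splits]

theorem splitSum_succ_nil (n : ℕ) (x y : List V → ZMod 2) : splitSum (n + 1) x y [] = 0 := by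
  simp [splitSum, splits]

theorem splitSum_zero_cons (x y : List V → ZMod 2) (v : V) (l : List V) :
    splitSum 0 x y (v :: l) = splitSum 0 (fun t => x (v :: t)) y l := by
  simp [splitSum, splits, Function.comp_def]

theorem splitSum_succ_cons (n : ℕ) (x y : List V → ZMod 2) (v : V) (l : List V) :
    splitSum (n + 1) x y (v :: l) = splitSum (n + 1) (fun t => x (v :: t)) y l +
      splitSum n (fun t => y (v :: t)) (fun t => x (v :: t)) l := by
  simp [splitSum, splits, Function.comp_def, mul_comm]

theorem splitSum_add_left (n : ℕ) (x x' y : List V → ZMod 2) (l : List V) :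
    splitSum n (fun t => x t + x' t) y l = splitSum n x y l + splitSum n x' y l := by
  simp [splitSum, add_mul, List.sum_map_add]

theorem splitSum_add_right (n : ℕ) (x y y' : List V → ZMod 2) (l : List V) :
    splitSum n x (fun t => y t + y' t) l = splitSum n x y l + splitSum n x y' l := by
  simp [splitSum, mul_add, List.sum_map_add]

theorem splitSum_zero (x y : List V → ZMod 2) (l : List V) :
    splitSum 0 x y l = x l * y [] := by
  induction l generalizing x with
  | nil => exact splitSum_zero_nil x y
  | cons v l ih => rw [splitSum_zero_cons, ih]

/-- The sum over the removals of one entry. -/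
def removalSum (x : List V → ZMod 2) (l : List V) : ZMod 2 :=
  match l with
  | [] => 0
  | v :: l => x l + removalSum (fun t => x (v :: t)) l

theorem removalSum_add (x y : List V → ZMod 2) (l : List V) :
    removalSum (fun t => x t + y t) l = removalSum x l + removalSum y l := by
  induction l generalizing x y with
  | nil => simp [removalSum]
  | cons v l ih => simp only [removalSum, ih]; ring

theorem removalSum_splitSum_zero (x y : List V → ZMod 2) (l : List V) :
    removalSum (splitSum 0 x y) l =
      splitSum 0 (removalSum x) y l + splitSum 0 x (removalSum y) l := by
  induction l generalizing x with
  | nil => simp [removalSum, splitSum_zero]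
  | cons v l ih =>
    simp only [removalSum, splitSum_zero_cons, ih, splitSum_add_left, add_assoc]

/-- The coboundary formula for the cup-`i` products. -/
theorem removalSum_splitSum_succ (n : ℕ) (x y : List V → ZMod 2) (l : List V) :
    removalSum (splitSum (n + 1) x y) l = splitSum n x y l + splitSum n y x l +
      splitSum (n + 1) (removalSum x) y l + splitSum (n + 1) x (removalSum y) l := by
  induction l generalizing n x y with
  | nil =>
    cases n with
    | zero =>
      simp only [removalSum, splitSum_zero_nil, splitSum_succ_nil, add_zero, mul_comm (y [])]
      exact (CharTwo.add_self_eq_zero _).symm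
    | succ n => simp [removalSum, splitSum_succ_nil]
  | cons v l ih =>
    have h2 := CharTwo.add_self_eq_zero (R := ZMod 2)
    cases n with
    | zero =>
      simp only [removalSum, splitSum_succ_cons, splitSum_zero_cons, removalSum_add, ih,
        splitSum_add_left, splitSum_add_right, removalSum_splitSum_zero]
      -- This term, where `v` is kept for `y` but not for `x`, occurs twice on the right: in the
      -- exchanged product, and from removing `v` from the list of `x` when `v` is shared.
      linear_combination -h2 (splitSum 0 (fun t => y (v :: t)) x l)
    | succ n =>
      simp only [removalSum, splitSum_succ_cons, removalSum_add, ih,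
        splitSum_add_left, splitSum_add_right]
      linear_combination -h2 (splitSum (n + 1) (fun t => y (v :: t)) x l)

/-- The distributions depend only on positions in the list, not on the entries. -/
theorem splitSum_map (φ : V → W) (n : ℕ) (x y : List W → ZMod 2) (l : List V) :
    splitSum n (fun t => x (t.map φ)) (fun t => y (t.map φ)) l = splitSum n x y (l.map φ) := by
  induction l generalizing n x y with
  | nil => cases n <;> simp [splitSum, splits]
  | cons v l ih =>
    cases n with
    | zero =>
      simp only [splitSum_zero_cons, List.map_cons]
      exact ih 0 (fun t => x (φ v :: t)) y
    | succ n =>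
      simp only [splitSum_succ_cons, List.map_cons]
      congr 1
      · exact ih (n + 1) (fun t => x (φ v :: t)) y
      · exact ih n (fun t => y (φ v :: t)) (fun t => x (φ v :: t))

/-- Each entry is dealt once and the `n` shared ones twice; both speakers receive all shared ones.
-/
theorem sublist_of_mem_splits {n : ℕ} {l : List V} {p : List V × List V} (hp : p ∈ splits n l) :
    p.1.Sublist l ∧ p.2.Sublist l ∧ p.1.length + p.2.length = l.length + n ∧
      n ≤ p.1.length ∧ n ≤ p.2.length := by
  induction l generalizing n p with
  | nil => cases n <;> simp_all [splits]
  | cons v l ih =>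
    have h1 {m : ℕ} {q : List V × List V} (hq : q ∈ splits m l) :
        (v :: q.1).Sublist (v :: l) ∧ q.2.Sublist (v :: l) ∧
          (v :: q.1).length + q.2.length = (v :: l).length + m ∧
          m ≤ (v :: q.1).length ∧ m ≤ q.2.length := by
      obtain ⟨a, b, c, d, e⟩ := ih hq
      exact ⟨a.cons_cons v, b.cons v, by simp; omega, by simp; omega, e⟩
    cases n with
    | zero =>
      simp only [splits, List.mem_map] at hp
      obtain ⟨q, hq, rfl⟩ := hp
      exact h1 hq
    | succ n =>
      simp only [splits, List.mem_append, List.mem_map] at hp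
      obtain ⟨q, hq, rfl⟩ | ⟨q, hq, rfl⟩ := hp
      · exact h1 hq
      · obtain ⟨a, b, c, d, e⟩ := ih hq
        exact ⟨b.cons_cons v, a.cons_cons v, by simp; omega, by simp; omega, by simp; omega⟩

/-- Only values on sublists matter. This lets identities that hold just for weakly increasing lists
be used inside a product. -/
theorem splitSum_congr {n : ℕ} {x x' y y' : List V → ZMod 2} {l : List V}
    (hx : ∀ t, t.Sublist l → x t = x' t) (hy : ∀ t, t.Sublist l → y t = y' t) :
    splitSum n x y l = splitSum n x' y' l := by
  unfold splitSum
  refine congrArg List.sum (List.map_congr_left fun p hp => ?_)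
  have := sublist_of_mem_splits hp
  rw [hx _ this.1, hy _ this.2.1]

theorem splitSum_of_length_lt {n : ℕ} {l : List V} (h : l.length < n) (x y : List V → ZMod 2) :
    splitSum n x y l = 0 := by
  induction l generalizing n x y with
  | nil => cases n <;> simp_all [splitSum, splits]
  | cons v l ih =>
    cases n with
    | zero => simp at h
    | succ n =>
      simp only [List.length_cons] at h
      rw [splitSum_succ_cons, ih (by omega), ih (by omega), add_zero]

/-- With as many shared entries as entries, everything is shared. This is the source of `x ∪_{|x|} x
= x`. -/
theorem splitSum_length (x y : List V → ZMod 2) (l : List V) :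
    splitSum l.length x y l = x l * y l := by
  induction l generalizing x y with
  | nil => exact splitSum_zero_nil x y
  | cons v l ih =>
    rw [List.length_cons, splitSum_succ_cons, splitSum_of_length_lt (by omega), zero_add, ih,
      mul_comm]

theorem splitSum_eq_zero_left {n : ℕ} {x : List V → ZMod 2} (hx : ∀ t, x t = 0)
    (y : List V → ZMod 2) (l : List V) : splitSum n x y l = 0 := by
  simp [splitSum, hx]

theorem splitSum_eq_zero_right {n : ℕ} (x : List V → ZMod 2) {y : List V → ZMod 2}
    (hy : ∀ t, y t = 0) (l : List V) : splitSum n x y l = 0 := by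
  simp [splitSum, hy]

/-- Cup-`i` products of normalized functions are normalized. -/
theorem splitSum_degenerate {n : ℕ} {x y : List V → ZMod 2} (l₁ : List V) (v : V) (l₂ : List V)
    (hx : ∀ t₁ v t₂, x (t₁ ++ v :: v :: t₂) = 0) (hy : ∀ t₁ v t₂, y (t₁ ++ v :: v :: t₂) = 0) :
    splitSum n x y (l₁ ++ v :: v :: l₂) = 0 := by
  induction l₁ generalizing n x y with
  | nil =>
    have hx' : ∀ t, x (v :: v :: t) = 0 := hx [] v
    have hy' : ∀ t, y (v :: v :: t) = 0 := hy [] v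
    -- The current speaker always receives the next entry, and whoever is current after the first
    -- copy of `v` already holds it. So in every distribution one of the speakers receives `v, v`.
    rcases n with _ | _ | n
    · simp only [List.nil_append, splitSum_zero_cons]
      exact splitSum_eq_zero_left hx' _ _
    · simp only [List.nil_append, splitSum_succ_cons, splitSum_zero_cons]
      rw [splitSum_eq_zero_left hx', splitSum_eq_zero_right _ hx', splitSum_eq_zero_left hy']
      simp
    · simp only [List.nil_append, splitSum_succ_cons]
      rw [splitSum_eq_zero_left hx', splitSum_eq_zero_right _ hx', splitSum_eq_zero_left hy',
        splitSum_eq_zero_left hx']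
      simp
  | cons a l₁ ih =>
    have hx' : ∀ t₁ v t₂, x (a :: (t₁ ++ v :: v :: t₂)) = 0 := fun t₁ => hx (a :: t₁)
    have hy' : ∀ t₁ v t₂, y (a :: (t₁ ++ v :: v :: t₂)) = 0 := fun t₁ => hy (a :: t₁)
    cases n with
    | zero =>
      rw [List.cons_append, splitSum_zero_cons, ih hx' hy]
    | succ n =>
      rw [List.cons_append, splitSum_succ_cons, ih hx' hy, ih hy' hx', add_zero]

theorem removalSum_ofFn (x : List V → ZMod 2) {d : ℕ} (z : Fin (d + 1) → V) :
    removalSum x (List.ofFn z) = ∑ i : Fin (d + 1), x (List.ofFn fun k => z (i.succAbove k)) := by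
  induction d generalizing x with
  | zero => simp [removalSum]
  | succ d ih =>
    rw [List.ofFn_succ, removalSum, ih, Fin.sum_univ_succ (n := d + 1)]
    congr 1
    refine Finset.sum_congr rfl fun i _ => ?_
    rw [List.ofFn_succ (f := fun k => z (i.succ.succAbove k))]
    simp

end Lists

/-! ### Cup-`i` products of cochains of a simplex -/

section Simplex

variable {V W : Type} [LinearOrder V] [LinearOrder W]

/-- A monotone map that is not injective takes equal values at two consecutive vertices, so it is a
degeneracy. -/
theorem NCochain.apply_of_not_injective (x : NCochain (simplex V)) {d : ℕ}
    (z : Fin (d + 1) →o V) (hz : ¬ Function.Injective z) : x.1 d z = 0 := by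
  cases d with
  | zero => exact absurd (fun a b _ => Fin.ext (by omega)) hz
  | succ d =>
    obtain ⟨j, hj⟩ : ∃ j : Fin (d + 1), z j.castSucc = z j.succ := by
      by_contra! h
      exact hz (Fin.strictMono_iff_lt_succ.2 fun j =>
        lt_of_le_of_ne (z.monotone (Fin.castSucc_lt_succ).le) (h j)).injective
    have : z = (simplex V).σ j ((simplex V).δ j.succ z) := by
      refine OrderHom.ext _ _ (funext fun k => ?_)
      change z k = z (j.succ.succAbove (j.predAbove k))
      by_cases hk : k = j.succ
      · subst hk
        rw [Fin.predAbove_succ_self, Fin.succAbove_of_castSucc_lt _ _ Fin.castSucc_lt_succ, hj]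
      · obtain ⟨k', rfl⟩ := Fin.exists_succAbove_eq hk
        congr 1
        rw [Fin.succ_succAbove_predAbove hk]
    rw [this]
    exact x.2 d j _

/-- The value of a cochain on the simplex with the given list of vertices, which is zero if the
list is empty or is not weakly increasing. -/
def onList (x : NCochain (simplex V)) (l : List V) : ZMod 2 :=
  match l with
  | [] => 0
  | v :: t => open scoped Classical in
    if h : Monotone (v :: t).get then x.1 t.length (⟨(v :: t).get, h⟩ : Fin (t.length + 1) →o V)
    else 0

theorem onList_add (x y : NCochain (simplex V)) (l : List V) :
    onList (x + y) l = onList x l + onList y l := by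
  cases l with
  | nil => simp [onList]
  | cons v t =>
    by_cases h : Monotone (v :: t).get
    · simp only [onList, dif_pos h]
      rfl
    · simp [onList, dif_neg h]

theorem onList_smul (r : ZMod 2) (x : NCochain (simplex V)) (l : List V) :
    onList (r • x) l = r * onList x l := by
  cases l with
  | nil => simp [onList]
  | cons v t =>
    by_cases h : Monotone (v :: t).get
    · simp only [onList, dif_pos h]
      rfl
    · simp [onList, dif_neg h]

theorem onList_ofFn (x : NCochain (simplex V)) {d : ℕ} (z : Fin (d + 1) →o V) :
    onList x (List.ofFn z) = x.1 d z := by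
  -- The length of the tail equals `d` only propositionally, so the simplex is compared with its
  -- reindexing.
  have aux : ∀ {d e : ℕ} (h : d = e) (z : Fin (d + 1) →o V) (w : Fin (e + 1) →o V),
      (∀ k, z k = w (Fin.cast (by omega) k)) → x.1 d z = x.1 e w := by
    rintro d _ rfl z w hzw
    rw [show z = w from OrderHom.ext _ _ (funext hzw)]
  obtain ⟨v, t, hl⟩ : ∃ v t, List.ofFn z = v :: t := ⟨_, _, List.ofFn_succ⟩
  have ht : t.length = d := by simpa using (congrArg List.length hl).symm
  have hget : ∀ k : Fin (t.length + 1), (v :: t).get k = z (Fin.cast (by omega) k) := by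
    intro k
    simp only [← hl, List.get_eq_getElem, List.getElem_ofFn]
    rfl
  have hm : Monotone (v :: t).get := by
    intro a b hab
    rw [hget, hget]
    exact z.monotone (by simpa using hab)
  rw [hl, onList, dif_pos hm]
  exact aux ht _ _ hget

theorem onList_degenerate (x : NCochain (simplex V)) (l₁ : List V) (v : V)
    (l₂ : List V) : onList x (l₁ ++ v :: v :: l₂) = 0 := by
  obtain ⟨a, t, hl⟩ : ∃ a t, l₁ ++ v :: v :: l₂ = a :: t := by
    cases l₁ <;> simp
  have hn : ¬ (a :: t).Nodup := by
    rw [← hl]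
    simp [List.nodup_append]
  rw [hl, onList]
  split_ifs with h
  · exact NCochain.apply_of_not_injective x _ fun hi => hn (List.nodup_iff_injective_get.2 hi)
  · rfl

/-- The nonempty lists that occur in a product are again faces of the simplex. -/
theorem exists_ofFn_of_sublist {m : ℕ} (z : Fin m →o V) {t : List V} (ht : t.Sublist (List.ofFn z))
    (h0 : t ≠ []) :
    ∃ (d : ℕ) (w : Fin (d + 1) →o V), t = List.ofFn w ∧ Set.range w ⊆ Set.range z := by
  obtain ⟨v, t, rfl⟩ := List.exists_cons_of_ne_nil h0
  have hp : (v :: t).Pairwise (· ≤ ·) :=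
    List.Pairwise.sublist ht (List.pairwise_ofFn.2 fun _ _ h => z.monotone h.le)
  refine ⟨t.length, ⟨(v :: t).get, ?_⟩, (List.ofFn_get (v :: t)).symm, ?_⟩
  · intro a b hab
    rcases hab.eq_or_lt with rfl | hab
    · exact le_rfl
    · exact List.pairwise_iff_get.1 hp a b hab
  · rintro _ ⟨k, rfl⟩
    have := ht.subset (List.get_mem (v :: t) k)
    rwa [List.mem_ofFn] at this

theorem splitSum_onList_degenerate (n : ℕ) (x y : NCochain (simplex V)) {d : ℕ} (j : Fin (d + 1))
    (z : Fin (d + 1) →o V) :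
    splitSum n (onList x) (onList y)
      (List.ofFn (show Fin (d + 2) →o V from (simplex V).σ j z)) = 0 := by
  set l := List.ofFn (show Fin (d + 2) →o V from (simplex V).σ j z) with hl
  have hlen : l.length = d + 2 := by simp [hl]
  have hj := j.2
  have h1 : l[(j : ℕ)] = z j := by
    simp only [hl, List.getElem_ofFn]
    exact congrArg z (Fin.predAbove_castSucc_self j)
  have h2 : l[(j : ℕ) + 1] = z j := by
    simp only [hl, List.getElem_ofFn]
    exact congrArg z (Fin.predAbove_succ_self j)
  have : l = l.take j ++ z j :: z j :: l.drop (j + 2) := by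
    conv_lhs => rw [← List.take_append_drop j l, List.drop_eq_getElem_cons (by omega), h1,
      List.drop_eq_getElem_cons (by omega), h2]
  rw [this]
  exact splitSum_degenerate _ _ _ (onList_degenerate x) (onList_degenerate y)

/-- The product of cochains of a simplex in which `n` vertices are common to both arguments. For
`n = i + 1` this is the cup-`i` product, and for `n = 0` it is zero. -/
def NCochain.prod (V : Type) [LinearOrder V] (n : ℕ) :
    NCochain (simplex V) →ₗ[ZMod 2] NCochain (simplex V) →ₗ[ZMod 2] NCochain (simplex V) :=
  LinearMap.mk₂ (ZMod 2)
    (fun x y => ⟨fun d z => splitSum n (onList x) (onList y)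
      (List.ofFn (show Fin (d + 1) →o V from z)), fun _ j z =>
        splitSum_onList_degenerate n x y j z⟩)
    (fun x x' y => Subtype.ext (funext fun d => funext fun z => by
      change splitSum n (fun l => onList (x + x') l) (onList y) _ = _
      simp only [onList_add, splitSum_add_left]
      rfl))
    (fun r x y => Subtype.ext (funext fun d => funext fun z => by
      change splitSum n (fun l => onList (r • x) l) (onList y) _ = r * splitSum n _ _ _
      simp only [onList_smul, splitSum, mul_assoc, List.sum_map_mul_left]))
    (fun x y y' => Subtype.ext (funext fun d => funext fun z => by
      change splitSum n (onList x) (fun l => onList (y + y') l) _ = _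
      simp only [onList_add, splitSum_add_right]
      rfl))
    (fun r x y => Subtype.ext (funext fun d => funext fun z => by
      change splitSum n (onList x) (fun l => onList (r • y) l) _ = r * splitSum n _ _ _
      simp only [onList_smul, splitSum, mul_left_comm _ r, List.sum_map_mul_left]))

theorem NCochain.prod_zero (x y : NCochain (simplex V)) : prod V 0 x y = 0 := by
  refine Subtype.ext (funext fun d => funext fun z => ?_)
  exact (splitSum_zero _ _ _).trans (mul_zero _)

theorem NCochain.map_prod (φ : V →o W) (n : ℕ) (x y : NCochain (simplex W)) :
    NCochain.map (simplexMap φ) (prod W n x y) =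
      prod V n (NCochain.map (simplexMap φ) x) (NCochain.map (simplexMap φ) y) := by
  refine Subtype.ext (funext fun d => funext fun (z : Fin (d + 1) →o V) => ?_)
  change splitSum n (onList x) (onList y) (List.ofFn (φ ∘ z)) = splitSum n _ _ (List.ofFn z)
  rw [← List.map_ofFn, ← splitSum_map]
  have key : ∀ (c : NCochain (simplex W)) (t : List V), t.Sublist (List.ofFn z) →
      onList c (t.map φ) = onList (NCochain.map (simplexMap φ) c) t := by
    intro c t ht
    rcases eq_or_ne t [] with rfl | h0
    · rfl
    · obtain ⟨e, w, rfl, -⟩ := exists_ofFn_of_sublist z ht h0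
      rw [onList_ofFn, List.map_ofFn]
      exact onList_ofFn c (φ.comp w)
  exact splitSum_congr (key x) (key y)

/-- The hypothesis `h0` handles vertices: the unaugmented coboundary vanishes in degree zero,
whereas removing the only entry gives `F []`. -/
theorem coboundaryFun_eq_removalSum (f : (d : ℕ) → (simplex V) _⦋d⦌ → ZMod 2)
    (F : List V → ZMod 2) (h0 : F [] = 0)
    (hF : ∀ (d : ℕ) (z : Fin (d + 1) →o V), f d z = F (List.ofFn z)) {d : ℕ}
    (z : Fin (d + 1) →o V) : coboundaryFun (simplex V) f d z = removalSum F (List.ofFn z) := by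
  rw [removalSum_ofFn]
  cases d with
  | zero => simp [coboundaryFun, h0]
  | succ d => exact Finset.sum_congr rfl fun i _ => hF d _

/-- The restriction to sublists of a simplex is needed: on a list that is not increasing the left
side is zero by convention, while removing an entry may produce an increasing list. -/
theorem δ_onList (x : NCochain (simplex V)) {m : ℕ} (z : Fin m →o V) {t : List V}
    (ht : t.Sublist (List.ofFn z)) :
    onList (NCochain.δ (simplex V) x) t = removalSum (onList x) t := by
  rcases eq_or_ne t [] with rfl | h0
  · rfl
  · obtain ⟨e, w, rfl, -⟩ := exists_ofFn_of_sublist z ht h0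
    rw [onList_ofFn]
    exact coboundaryFun_eq_removalSum x.1 (onList x) rfl (fun d z => (onList_ofFn x z).symm) w

theorem NCochain.δ_prod (n : ℕ) (x y : NCochain (simplex V)) :
    NCochain.δ (simplex V) (prod V (n + 1) x y) = prod V n x y + prod V n y x +
      prod V (n + 1) (NCochain.δ (simplex V) x) y + prod V (n + 1) x (NCochain.δ (simplex V) y) := by
  refine Subtype.ext (funext fun d => funext fun (z : Fin (d + 1) →o V) => ?_)
  have h := coboundaryFun_eq_removalSum (prod V (n + 1) x y).1
    (splitSum (n + 1) (onList x) (onList y)) (splitSum_succ_nil _ _ _) (fun _ _ => rfl) z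
  refine h.trans ((removalSum_splitSum_succ n (onList x) (onList y) (List.ofFn z)).trans ?_)
  change _ = splitSum n (onList x) (onList y) (List.ofFn z) +
    splitSum n (onList y) (onList x) (List.ofFn z) +
    splitSum (n + 1) _ (onList y) (List.ofFn z) + splitSum (n + 1) (onList x) _ (List.ofFn z)
  congr 1
  · congr 1
    exact splitSum_congr (fun t ht => ((δ_onList x) z ht).symm) fun _ _ => rfl
  · exact splitSum_congr (fun _ _ => rfl) fun t ht => ((δ_onList y) z ht).symm

/-- The vertices of a simplex of a standard simplex. -/
def vertices (z : Σ d : ℕ, (simplex V) _⦋d⦌) : Set V :=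
  Set.range (show Fin (z.1 + 1) →o V from z.2)

/-- `(u, w)` is a pair of faces of `z` that can contribute to the value of a cup-`j` product. -/
structure IsCupPair (j : ℕ) (z u w : Σ d : ℕ, (simplex V) _⦋d⦌) : Prop where
  dim_add : u.1 + w.1 = z.1 + j
  le_left : j ≤ u.1
  le_right : j ≤ w.1
  vertices_left : vertices u ⊆ vertices z
  vertices_right : vertices w ⊆ vertices z

theorem IsCupPair.symm {j : ℕ} {z u w : Σ d : ℕ, (simplex V) _⦋d⦌} (h : IsCupPair j z u w) :
    IsCupPair j z w u :=
  ⟨by rw [add_comm, h.dim_add], h.le_right, h.le_left, h.vertices_right, h.vertices_left⟩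

/-- The index set consists of the distributions of the vertex list of `z` with `j + 1` shared
entries. Dimensions are one less than lengths, which turns `j + 1` into `j` in `IsCupPair`. -/
theorem NCochain.eval_prod (j : ℕ) (z : Σ d : ℕ, (simplex V) _⦋d⦌) :
    ∃ (ι : Type) (_ : Fintype ι) (u w : ι → Σ d : ℕ, (simplex V) _⦋d⦌),
      (∀ t, IsCupPair j z (u t) (w t)) ∧ ∀ x y : NCochain (simplex V),
        eval _ z (prod V (j + 1) x y) = ∑ t, eval _ (u t) x * eval _ (w t) y := by
  obtain ⟨d, z⟩ := z
  change Fin (d + 1) →o V at z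
  let S := splits (j + 1) (List.ofFn z)
  have hS : ∀ t : Fin S.length, ∃ u w : Σ d : ℕ, (simplex V) _⦋d⦌, IsCupPair j ⟨d, z⟩ u w ∧
      ∀ x : NCochain (simplex V), onList x S[t].1 = eval _ u x ∧ onList x S[t].2 = eval _ w x := by
    intro t
    obtain ⟨h1, h2, h3, h4, h5⟩ := sublist_of_mem_splits (S.getElem_mem t.2)
    obtain ⟨a, u, hu, hu'⟩ := exists_ofFn_of_sublist z h1 (List.length_pos_iff.1 (by omega))
    obtain ⟨b, w, hw, hw'⟩ := exists_ofFn_of_sublist z h2 (List.length_pos_iff.1 (by omega))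
    have ha : S[(t : ℕ)].1.length = a + 1 := by simp [hu]
    have hb : S[(t : ℕ)].2.length = b + 1 := by simp [hw]
    have hd : (List.ofFn z).length = d + 1 := by simp
    refine ⟨⟨a, u⟩, ⟨b, w⟩, ⟨?_, ?_, ?_, hu', hw'⟩, fun x => ⟨?_, ?_⟩⟩
    · change a + b = d + j
      omega
    · change j ≤ a
      omega
    · change j ≤ b
      omega
    · exact (congrArg (onList x) hu).trans (onList_ofFn x u)
    · exact (congrArg (onList x) hw).trans (onList_ofFn x w)
  choose u w h h' using hS
  refine ⟨Fin S.length, inferInstance, u, w, h, fun x y => ?_⟩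
  change (S.map fun p => (onList x) p.1 * (onList y) p.2).sum = _
  rw [← Fin.sum_univ_fun_getElem]
  exact Finset.sum_congr rfl fun t _ => by rw [← (h' t x).1, ← (h' t y).2]; rfl

theorem NCochain.eval_prod_top (z : Σ d : ℕ, (simplex V) _⦋d⦌) (x y : NCochain (simplex V)) :
    eval _ z (prod V (z.1 + 1) x y) = eval _ z x * eval _ z y := by
  obtain ⟨d, z⟩ := z
  change Fin (d + 1) →o V at z
  have h := splitSum_length (onList x) (onList y) (List.ofFn z)
  rw [List.length_ofFn, onList_ofFn, onList_ofFn] at h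
  exact h

end Simplex

/-! ### The coefficients determine a local cochain -/

section Basis

variable {V : Type} [LinearOrder V]

/-- The nondegenerate simplices of a standard simplex. -/
abbrev NondegenerateSimplex (V : Type) [LinearOrder V] : Type :=
  {z : Σ d : ℕ, (simplex V) _⦋d⦌ // Function.Injective (show Fin (z.1 + 1) →o V from z.2)}

instance [Finite V] : Finite (NondegenerateSimplex V) := by
  classical
  have := Fintype.ofFinite V
  refine Finite.of_injective (β := {l : List V // l.Nodup})
    (fun z => ⟨List.ofFn (show Fin (z.1.1 + 1) →o V from z.1.2), List.nodup_ofFn.2 z.2⟩) ?_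
  rintro ⟨⟨d, z⟩, hz⟩ ⟨⟨e, w⟩, hw⟩ h
  change Fin (d + 1) →o V at z
  change Fin (e + 1) →o V at w
  have h' : List.ofFn z = List.ofFn w := congrArg Subtype.val h
  obtain rfl : d = e := by simpa using congrArg List.length h'
  obtain rfl : z = w := OrderHom.ext _ _ (List.ofFn_injective h')
  rfl

/-- A normalized cochain is given by its values on the nondegenerate simplices. -/
noncomputable def NCochain.equivFun (V : Type) [LinearOrder V] :
    NCochain (simplex V) ≃ₗ[ZMod 2] (NondegenerateSimplex V → ZMod 2) where
  toFun x z := x.1 z.1.1 z.1.2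
  map_add' _ _ := rfl
  map_smul' _ _ := rfl
  invFun g := open scoped Classical in ⟨fun d z =>
    if h : Function.Injective (show Fin (d + 1) →o V from z) then g ⟨⟨d, z⟩, h⟩ else 0,
    fun d j z => dif_neg fun h => by
      have := h (a₁ := j.castSucc) (a₂ := j.succ) <| by
        change (show Fin (d + 1) →o V from z) (j.predAbove j.castSucc) =
          (show Fin (d + 1) →o V from z) (j.predAbove j.succ)
        rw [Fin.predAbove_castSucc_self, Fin.predAbove_succ_self]
      simpa using congrArg Fin.val this⟩
  left_inv x := Subtype.ext <| funext fun d => funext fun z => by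
    by_cases h : Function.Injective (show Fin (d + 1) →o V from z)
    · exact dif_pos h
    · exact (dif_neg h).trans (NCochain.apply_of_not_injective x _ h).symm
  right_inv g := funext fun z => dif_pos z.2

end Basis

section Local

variable {n : ℕ} {a : FilteredSimplex n}

theorem coeff_tprod (z : Cell a) (x : ∀ i, NCochain (factor a i)) :
    coeff z (PiTensorProduct.tprod (ZMod 2) x) = ∏ i, NCochain.eval _ (z i) (x i) := by
  simp [coeff]

/-- Each factor has finitely many vertices, so the cochains dual to nondegenerate simplices form a
basis. The coefficients on cells of nondegenerate simplices are the coordinates in the tensor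
product basis. -/
theorem eq_of_coeff_eq {x y : LocalBlowup a} (h : ∀ z, coeff z x = coeff z y) : x = y := by
  let b := fun i => Module.Basis.ofEquivFun (NCochain.equivFun (Vertex a i))
  refine (Basis.piTensorProduct b).ext_elem fun p => ?_
  have key : ∀ c, (Basis.piTensorProduct b).repr c p = coeff (fun i => (p i).1) c := by
    intro c
    induction c using PiTensorProduct.induction_on with
    | smul_tprod r c =>
      simp only [map_smul, Finsupp.smul_apply, coeff_tprod, Basis.piTensorProduct_repr_tprod_apply]
      rfl
    | add c c' hc hc' => rw [map_add, map_add, Finsupp.add_apply, hc, hc']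
  rw [key, key, h]

theorem bilinear_ext {M : Type*} [AddCommGroup M] [Module (ZMod 2) M]
    {f g : LocalBlowup a →ₗ[ZMod 2] LocalBlowup a →ₗ[ZMod 2] M}
    (h : ∀ x y : ∀ i, NCochain (factor a i), f (PiTensorProduct.tprod _ x)
      (PiTensorProduct.tprod _ y) = g (PiTensorProduct.tprod _ x) (PiTensorProduct.tprod _ y)) :
    f = g :=
  PiTensorProduct.ext <| MultilinearMap.ext fun x =>
    PiTensorProduct.ext <| MultilinearMap.ext fun y => h x y

/-! ### Cup-`i` products of local cochains -/

/-- The product with `n` common vertices, with the arguments exchanged `e` times. -/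
def NCochain.twistedProd (V : Type) [LinearOrder V] (n e : ℕ) :
    NCochain (simplex V) →ₗ[ZMod 2] NCochain (simplex V) →ₗ[ZMod 2] NCochain (simplex V) :=
  if Even e then prod V n else (prod V n).flip

theorem NCochain.twistedProd_succ {V : Type} [LinearOrder V] (n e : ℕ)
    (x y : NCochain (simplex V)) : twistedProd V n (e + 1) x y = twistedProd V n e y x := by
  by_cases h : Even e <;> simp [twistedProd, h, Nat.even_add_one]

theorem NCochain.twistedProd_zero {V : Type} [LinearOrder V] (e : ℕ)
    (x y : NCochain (simplex V)) : twistedProd V 0 e x y = 0 := by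
  by_cases h : Even e <;> simp [twistedProd, h, prod_zero]

theorem NCochain.δ_twistedProd {V : Type} [LinearOrder V] (n e : ℕ) (x y : NCochain (simplex V)) :
    NCochain.δ _ (twistedProd V (n + 1) e x y) = twistedProd V n e x y +
      twistedProd V n (e + 1) x y + twistedProd V (n + 1) e (NCochain.δ _ x) y +
        twistedProd V (n + 1) e x (NCochain.δ _ y) := by
  rw [twistedProd_succ]
  by_cases h : Even e
  · simp [twistedProd, h, δ_prod]
  · simp only [twistedProd, h, if_false, LinearMap.flip_apply, δ_prod]
    abel

theorem NCochain.map_twistedProd {V W : Type} [LinearOrder V] [LinearOrder W] (φ : V →o W)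
    (n e : ℕ) (x y : NCochain (simplex W)) :
    NCochain.map (simplexMap φ) (twistedProd W n e x y) =
      twistedProd V n e (NCochain.map (simplexMap φ) x) (NCochain.map (simplexMap φ) y) := by
  by_cases h : Even e <;> simp [twistedProd, h, map_prod]

theorem NCochain.eval_twistedProd {V : Type} [LinearOrder V] (j e : ℕ)
    (z : Σ d : ℕ, (simplex V) _⦋d⦌) :
    ∃ (ι : Type) (_ : Fintype ι) (u w : ι → Σ d : ℕ, (simplex V) _⦋d⦌),
      (∀ t, IsCupPair j z (u t) (w t)) ∧ ∀ x y : NCochain (simplex V),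
        eval _ z (twistedProd V (j + 1) e x y) = ∑ t, eval _ (u t) x * eval _ (w t) y := by
  obtain ⟨ι, hι, u, w, h, h'⟩ := eval_prod j z
  by_cases he : Even e
  · exact ⟨ι, hι, u, w, h, fun x y => by simp [twistedProd, he, h']⟩
  · exact ⟨ι, hι, w, u, fun t => (h t).symm, fun x y => by
      simp [twistedProd, he, h', mul_comm]⟩

theorem NCochain.eval_twistedProd_top {V : Type} [LinearOrder V] (e : ℕ)
    (z : Σ d : ℕ, (simplex V) _⦋d⦌) (x y : NCochain (simplex V)) :
    eval _ z (twistedProd V (z.1 + 1) e x y) = eval _ z x * eval _ z y := by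
  by_cases he : Even e <;> simp [twistedProd, he, eval_prod_top, mul_comm]

/-- The tensor product of the products with `j k` common vertices, with the arguments exchanged
`e k` times, in the `k`-th factor. -/
noncomputable def tensorProd (a : FilteredSimplex n) (j e : Fin (n + 1) → ℕ) :
    LocalBlowup a →ₗ[ZMod 2] LocalBlowup a →ₗ[ZMod 2] LocalBlowup a :=
  PiTensorProduct.map₂ fun k => NCochain.twistedProd (Vertex a k) (j k) (e k)

theorem tensorProd_tprod (j e : Fin (n + 1) → ℕ) (x y : ∀ i, NCochain (factor a i)) :
    tensorProd a j e (PiTensorProduct.tprod _ x) (PiTensorProduct.tprod _ y) =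
      PiTensorProduct.tprod _ fun k => NCochain.twistedProd _ (j k) (e k) (x k) (y k) :=
  PiTensorProduct.map₂_tprod_tprod _ _ _

theorem tensorProd_succ (j e : Fin (n + 1) → ℕ) (x y : LocalBlowup a) :
    tensorProd a j (fun k => e k + 1) x y = tensorProd a j e y x := by
  suffices h : tensorProd a j (fun k => e k + 1) = (tensorProd a j e).flip by
    rw [h, LinearMap.flip_apply]
  refine bilinear_ext fun x y => ?_
  rw [LinearMap.flip_apply, tensorProd_tprod, tensorProd_tprod]
  simp only [NCochain.twistedProd_succ]

theorem tensorProd_of_eq_zero {j : Fin (n + 1) → ℕ} {k : Fin (n + 1)} (hk : j k = 0)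
    (e : Fin (n + 1) → ℕ) : tensorProd a j e = 0 := by
  refine bilinear_ext fun x y => ?_
  rw [tensorProd_tprod]
  refine MultilinearMap.map_coord_zero _ k ?_
  rw [hk, NCochain.twistedProd_zero]

theorem localδAt_tprod (k : Fin (n + 1)) (x : ∀ i, NCochain (factor a i)) :
    localδAt a k (PiTensorProduct.tprod _ x) =
      PiTensorProduct.tprod _ (Function.update x k (NCochain.δ _ (x k))) := by
  rw [localδAt, PiTensorProduct.map_tprod]
  congr 1
  funext l
  by_cases h : l = k
  · subst h; simp
  · simp [Function.update_of_ne h]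

/-- The formula for one simplex, applied in factor `k`. Swapping the arguments there alone is one
more exchange in position `k`, which is why exchanges are recorded factor by factor. -/
theorem localδAt_tensorProd {j : Fin (n + 1) → ℕ} (k : Fin (n + 1)) {m : ℕ} (hm : j k = m + 1)
    (e : Fin (n + 1) → ℕ) (x y : LocalBlowup a) :
    localδAt a k (tensorProd a j e x y) = tensorProd a (Function.update j k m) e x y +
      tensorProd a (Function.update j k m) (Function.update e k (e k + 1)) x y +
      tensorProd a j e (localδAt a k x) y + tensorProd a j e x (localδAt a k y) := by
  suffices h : (tensorProd a j e).compr₂ (localδAt a k) =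
      tensorProd a (Function.update j k m) e +
        tensorProd a (Function.update j k m) (Function.update e k (e k + 1)) +
        (tensorProd a j e).comp (localδAt a k) + (tensorProd a j e).compl₂ (localδAt a k) from
    LinearMap.congr_fun (LinearMap.congr_fun h x) y
  refine bilinear_ext fun x y => ?_
  simp only [LinearMap.compr₂_apply, LinearMap.add_apply, LinearMap.comp_apply,
    LinearMap.compl₂_apply, localδAt_tprod, tensorProd_tprod]
  have h1 := NCochain.δ_twistedProd m (e k) (x k) (y k)
  rw [← hm] at h1
  rw [h1, MultilinearMap.map_update_add, MultilinearMap.map_update_add,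
    MultilinearMap.map_update_add]
  congr 1
  · congr 1
    · congr 1
      all_goals
        congr 1
        funext l
        by_cases h : l = k
        · subst h; simp
        · simp [Function.update_of_ne h]
    · congr 1
      funext l
      by_cases h : l = k
      · subst h; simp [hm]
      · simp [Function.update_of_ne h]
  · congr 1
    funext l
    by_cases h : l = k
    · subst h; simp [hm]
    · simp [Function.update_of_ne h]

theorem pullback_tensorProd {b : FilteredSimplex n} (f : a ⟶ b) (j e : Fin (n + 1) → ℕ)
    (x y : LocalBlowup b) :
    pullback f (tensorProd b j e x y) = tensorProd a j e (pullback f x) (pullback f y) := by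
  suffices h : (tensorProd b j e).compr₂ (pullback f) =
      (tensorProd a j e).compl₁₂ (pullback f) (pullback f) from
    LinearMap.congr_fun (LinearMap.congr_fun h x) y
  refine bilinear_ext fun x y => ?_
  simp only [LinearMap.compr₂_apply, LinearMap.compl₁₂_apply, pullback, tensorProd_tprod,
    PiTensorProduct.map_tprod, NCochain.map_twistedProd]

theorem coeff_tensorProd (j e : Fin (n + 1) → ℕ) (z : Cell a) :
    ∃ (ι : Type) (_ : Fintype ι) (u w : ι → Cell a),
      (∀ t k, IsCupPair (j k) (z k) (u t k) (w t k)) ∧ ∀ x y : LocalBlowup a,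
        coeff z (tensorProd a (fun k => j k + 1) e x y) =
          ∑ t, coeff (u t) x * coeff (w t) y := by
  choose ι hι u w h h' using fun k => NCochain.eval_twistedProd (j k) (e k) (z k)
  refine ⟨∀ k, ι k, inferInstance, fun t k => u k (t k), fun t k => w k (t k),
    fun t k => h k (t k), fun x y => ?_⟩
  suffices H : (tensorProd a (fun k => j k + 1) e).compr₂ (coeff z) =
      ∑ t : ∀ k, ι k, (LinearMap.mul (ZMod 2) (ZMod 2)).compl₁₂ (coeff fun k => u k (t k))
        (coeff fun k => w k (t k)) by
    simpa [LinearMap.sum_apply] using LinearMap.congr_fun (LinearMap.congr_fun H x) y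
  refine bilinear_ext fun x y => ?_
  simp only [LinearMap.compr₂_apply, LinearMap.sum_apply, LinearMap.compl₁₂_apply,
    LinearMap.mul_apply', tensorProd_tprod, coeff_tprod, h', ← Finset.prod_mul_distrib]
  -- Expanding the product of sums: a term picks one distribution in each factor.
  rw [Finset.prod_univ_sum, Fintype.piFinset_univ]

theorem coeff_tensorProd_top (e : Fin (n + 1) → ℕ) (z : Cell a) (x y : LocalBlowup a) :
    coeff z (tensorProd a (fun k => (z k).1 + 1) e x y) = coeff z x * coeff z y := by
  suffices H : (tensorProd a (fun k => (z k).1 + 1) e).compr₂ (coeff z) =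
      (LinearMap.mul (ZMod 2) (ZMod 2)).compl₁₂ (coeff z) (coeff z) from
    LinearMap.congr_fun (LinearMap.congr_fun H x) y
  refine bilinear_ext fun x y => ?_
  simp only [LinearMap.compr₂_apply, LinearMap.compl₁₂_apply, LinearMap.mul_apply',
    tensorProd_tprod, coeff_tprod, NCochain.eval_twistedProd_top, Finset.prod_mul_distrib]

/-- The cup-`i` product of local cochains, for the diagonal
`e_i ↦ ∑ e_{j₀} ⊗ τ^{j₀} e_{j₁} ⊗ τ^{j₀ + j₁} e_{j₂} ⊗ ⋯` of the resolution. -/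
noncomputable def localCup (a : FilteredSimplex n) (i : ℕ) :
    LocalBlowup a →ₗ[ZMod 2] LocalBlowup a →ₗ[ZMod 2] LocalBlowup a :=
  ∑ j ∈ Finset.univ.piAntidiag i,
    tensorProd a (fun k => j k + 1) fun k => ∑ l ∈ Finset.Iio k, j l

theorem localCup_apply (i : ℕ) (x y : LocalBlowup a) :
    localCup a i x y = ∑ j ∈ Finset.univ.piAntidiag i,
      tensorProd a (fun k => j k + 1) (fun k => ∑ l ∈ Finset.Iio k, j l) x y := by
  simp [localCup, LinearMap.sum_apply]

theorem pullback_localCup {b : FilteredSimplex n} (f : a ⟶ b) (i : ℕ) (x y : LocalBlowup b) :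
    pullback f (localCup b i x y) = localCup a i (pullback f x) (pullback f y) := by
  simp only [localCup_apply, map_sum, pullback_tensorProd]

/-- The defect of the product rule in the `k`-th factor, in the summand with index `j`. -/
noncomputable def cupDefect (x y : LocalBlowup a) (j : Fin (n + 1) → ℕ) (k : Fin (n + 1)) :
    LocalBlowup a :=
  tensorProd a (Function.update (fun l => j l + 1) k (j k)) (fun k => ∑ l ∈ Finset.Iio k, j l) x y +
    tensorProd a (Function.update (fun l => j l + 1) k (j k))
      (Function.update (fun k => ∑ l ∈ Finset.Iio k, j l) k ((∑ l ∈ Finset.Iio k, j l) + 1)) x y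

theorem localδ_localCup (i : ℕ) (x y : LocalBlowup a) :
    localδ a (localCup a i x y) =
      (∑ k, ∑ j ∈ Finset.univ.piAntidiag i, cupDefect x y j k) +
        localCup a i (localδ a x) y + localCup a i x (localδ a y) := by
  simp only [localCup_apply, localδ, LinearMap.sum_apply, map_sum]
  rw [Finset.sum_comm (s := Finset.univ.piAntidiag i)]
  rw [← Finset.sum_add_distrib, ← Finset.sum_add_distrib]
  refine Finset.sum_congr rfl fun k _ => ?_
  rw [← Finset.sum_add_distrib, ← Finset.sum_add_distrib]
  exact Finset.sum_congr rfl fun j _ => localδAt_tensorProd k rfl _ x y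

/-- Lowering `j_k = 0` leaves no shared vertex in factor `k`, and the product there is zero. -/
theorem cupDefect_of_eq_zero (x y : LocalBlowup a) {j : Fin (n + 1) → ℕ} {k : Fin (n + 1)}
    (hk : j k = 0) : cupDefect x y j k = 0 := by
  have : Function.update (fun l => j l + 1) k (j k) k = 0 := by simp [hk]
  rw [cupDefect, tensorProd_of_eq_zero this, tensorProd_of_eq_zero this]
  simp

/-- Raising `j_k` by one adds an exchange to every later factor. The extra exchange at `k` itself
turns the threshold `k + 1` into `k`, so consecutive values of `k` share a term. -/
theorem cupDefect_add_single (x y : LocalBlowup a) (j : Fin (n + 1) → ℕ) (k : Fin (n + 1)) :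
    cupDefect x y (j + Pi.single k 1) k =
      tensorProd a (fun l => j l + 1)
        (fun m => (∑ l ∈ Finset.Iio m, j l) + if (k : ℕ) + 1 ≤ m then 1 else 0) x y +
      tensorProd a (fun l => j l + 1)
        (fun m => (∑ l ∈ Finset.Iio m, j l) + if (k : ℕ) ≤ m then 1 else 0) x y := by
  have h1 : Function.update (fun l => (j + Pi.single k 1 : Fin (n + 1) → ℕ) l + 1) k
      ((j + Pi.single k 1 : Fin (n + 1) → ℕ) k) = fun l => j l + 1 := by
    funext l
    by_cases h : l = k
    · subst h; simp
    · simp [h]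
  have h2 : ∀ m : Fin (n + 1), ∑ l ∈ Finset.Iio m, (j + Pi.single k 1 : Fin (n + 1) → ℕ) l =
      (∑ l ∈ Finset.Iio m, j l) + if (k : ℕ) + 1 ≤ m then 1 else 0 := by
    intro m
    simp [Finset.sum_add_distrib]
  rw [cupDefect, h1]
  simp only [h2]
  congr 3
  congr 1
  funext m
  by_cases h : m = k
  · subst h; simp
  · have : (m : ℕ) ≠ k := fun hh => h (Fin.ext hh)
    rw [Function.update_of_ne h]
    congr 2
    simp only [eq_iff_iff]
    omega

theorem LocalBlowup.add_self (x : LocalBlowup a) : x + x = 0 := by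
  rw [← two_smul (ZMod 2), show (2 : ZMod 2) = 0 from rfl, zero_smul]

theorem LocalBlowup.sum_range_telescope (T : ℕ → LocalBlowup a) (N : ℕ) :
    ∑ k ∈ Finset.range N, (T (k + 1) + T k) = T N + T 0 := by
  induction N with
  | zero => rw [Finset.sum_range_zero, add_self]
  | succ N ih =>
    rw [Finset.sum_range_succ, ih, add_comm, add_assoc, ← add_assoc (T N), add_self, zero_add]

theorem sum_cupDefect_add_single (x y : LocalBlowup a) (j : Fin (n + 1) → ℕ) :
    ∑ k, cupDefect x y (j + Pi.single k 1) k =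
      tensorProd a (fun l => j l + 1) (fun m => ∑ l ∈ Finset.Iio m, j l) x y +
      tensorProd a (fun l => j l + 1) (fun m => ∑ l ∈ Finset.Iio m, j l) y x := by
  have h := LocalBlowup.sum_range_telescope (fun k => tensorProd a (fun l => j l + 1)
    (fun m => (∑ l ∈ Finset.Iio m, j l) + if k ≤ m then 1 else 0) x y) (n + 1)
  rw [← Fin.sum_univ_eq_sum_range (fun k => tensorProd a (fun l => j l + 1)
    (fun m => (∑ l ∈ Finset.Iio m, j l) + if k + 1 ≤ m then 1 else 0) x y +
      tensorProd a (fun l => j l + 1)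
    (fun m => (∑ l ∈ Finset.Iio m, j l) + if k ≤ m then 1 else 0) x y)] at h
  rw [Finset.sum_congr rfl fun k _ => cupDefect_add_single x y j k, h, ← tensorProd_succ _ _ x y]
  have h1 : ∀ m : Fin (n + 1), ¬ n + 1 ≤ (m : ℕ) := fun m => m.2.not_ge
  -- At the two ends of the telescope the threshold `n + 1` is met by no factor and the threshold
  -- `0` by all; exchanging in all factors swaps `x` and `y`.
  simp only [h1, if_false, add_zero, Nat.zero_le, if_true]

theorem sum_cupDefect_succ (i : ℕ) (x y : LocalBlowup a) :
    ∑ k, ∑ j ∈ Finset.univ.piAntidiag (i + 1), cupDefect x y j k =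
      localCup a i x y + localCup a i y x := by
  have h : ∀ k, ∑ j ∈ Finset.univ.piAntidiag (i + 1), cupDefect x y j k =
      ∑ j ∈ Finset.univ.piAntidiag i, cupDefect x y (j + Pi.single k 1) k := by
    intro k
    -- Tuples with `j_k = 0` contribute nothing; on the others, subtracting the unit vector is a
    -- bijection onto the tuples of sum `i`.
    rw [← Finset.sum_filter_of_ne (p := fun j : Fin (n + 1) → ℕ => j k ≠ 0)
      fun j _ hj h0 => hj (cupDefect_of_eq_zero x y h0)]
    have hs : ∀ j : Fin (n + 1) → ℕ, j k ≠ 0 → j - Pi.single k 1 + Pi.single k 1 = j := by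
      intro j hj
      funext l
      by_cases h : l = k
      · subst h; simp; omega
      · simp [h]
    refine Finset.sum_nbij' (fun j => j - Pi.single k 1) (fun j => j + Pi.single k 1) ?_ ?_ ?_ ?_ ?_
    · intro j hj
      simp only [Finset.mem_filter, Finset.mem_piAntidiag] at hj
      have h4 : ∑ l, (j - Pi.single k 1 : Fin (n + 1) → ℕ) l + 1 = ∑ l, j l := by
        conv_rhs => rw [← hs j hj.2]
        simp [Finset.sum_add_distrib]
      refine Finset.mem_piAntidiag.2 ⟨?_, fun l _ => Finset.mem_univ l⟩
      exact Nat.succ_injective (h4.trans hj.1.1)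
    · intro j hj
      simp only [Finset.mem_piAntidiag] at hj
      simp [Finset.sum_add_distrib, hj.1]
    · intro j hj
      exact hs j (Finset.mem_filter.1 hj).2
    · intro j _
      simp
    · intro j hj
      rw [hs j (Finset.mem_filter.1 hj).2]
  simp only [h]
  rw [Finset.sum_comm]
  simp only [sum_cupDefect_add_single, Finset.sum_add_distrib, localCup_apply]

theorem localδ_localCup_zero (x y : LocalBlowup a) :
    localδ a (localCup a 0 x y) = localCup a 0 (localδ a x) y + localCup a 0 x (localδ a y) := by
  rw [localδ_localCup, Finset.sum_eq_zero, zero_add]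
  intro k _
  rw [Finset.piAntidiag_zero, Finset.sum_singleton]
  exact cupDefect_of_eq_zero x y rfl

theorem localδ_localCup_succ (i : ℕ) (x y : LocalBlowup a) :
    localδ a (localCup a (i + 1) x y) = localCup a i x y + localCup a i y x +
      localCup a (i + 1) (localδ a x) y + localCup a (i + 1) x (localδ a y) := by
  rw [localδ_localCup, sum_cupDefect_succ]

/-! ### Degree, vanishing and squares of local products -/

theorem exists_of_coeff_localCup_ne_zero {i : ℕ} {z : Cell a} {x y : LocalBlowup a}
    (h : coeff z (localCup a i x y) ≠ 0) :
    ∃ (j : Fin (n + 1) → ℕ) (u w : Cell a), ∑ k, j k = i ∧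
      (∀ k, IsCupPair (j k) (z k) (u k) (w k)) ∧ coeff u x ≠ 0 ∧ coeff w y ≠ 0 := by
  rw [localCup_apply, map_sum] at h
  obtain ⟨j, hj, h⟩ := Finset.exists_ne_zero_of_sum_ne_zero h
  obtain ⟨ι, _, u, w, h1, h2⟩ := coeff_tensorProd j (fun k => ∑ l ∈ Finset.Iio k, j l) z
  rw [h2] at h
  obtain ⟨t, -, h⟩ := Finset.exists_ne_zero_of_sum_ne_zero h
  exact ⟨j, u t, w t, (Finset.mem_piAntidiag.1 hj).1, h1 t, left_ne_zero_of_mul h,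
    right_ne_zero_of_mul h⟩

theorem IsHomogeneous.localCup {i : ℕ} {s t m : ℤ} (hm : m + i = s + t) {x y : LocalBlowup a}
    (hx : IsHomogeneous s x) (hy : IsHomogeneous t y) :
    IsHomogeneous m (localCup a i x y) := by
  intro z hz
  obtain ⟨j, u, w, hj, h, hu, hw⟩ := exists_of_coeff_localCup_ne_zero hz
  have h1 := hx u hu
  have h2 := hy w hw
  have h3 : ∑ k, (((u k).1 : ℤ) + (w k).1) = ∑ k, (((z k).1 : ℤ) + j k) :=
    Finset.sum_congr rfl fun k _ => by exact_mod_cast (h k).dim_add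
  rw [Finset.sum_add_distrib, Finset.sum_add_distrib, h1, h2, ← Nat.cast_sum _ j, hj] at h3
  linarith

theorem localCup_eq_zero {i : ℕ} {s t : ℤ} (hi : min s t < i) {x y : LocalBlowup a}
    (hx : IsHomogeneous s x) (hy : IsHomogeneous t y) : localCup a i x y = 0 := by
  refine eq_of_coeff_eq fun z => ?_
  rw [map_zero]
  by_contra hz
  obtain ⟨j, u, w, hj, h, hu, hw⟩ := exists_of_coeff_localCup_ne_zero hz
  have h1 := hx u hu
  have h2 := hy w hw
  have h3 : ∑ k, (j k : ℤ) ≤ ∑ k, ((u k).1 : ℤ) :=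
    Finset.sum_le_sum fun k _ => by exact_mod_cast (h k).le_left
  have h4 : ∑ k, (j k : ℤ) ≤ ∑ k, ((w k).1 : ℤ) :=
    Finset.sum_le_sum fun k _ => by exact_mod_cast (h k).le_right
  rw [← Nat.cast_sum, hj] at h3 h4
  rw [h1] at h3
  rw [h2] at h4
  exact absurd hi (not_lt.2 (le_min h3 h4))

theorem localCup_self {d : ℕ} {x : LocalBlowup a} (hx : IsHomogeneous (d : ℤ) x) :
    localCup a d x x = x := by
  refine eq_of_coeff_eq fun z => ?_
  have h0 : ∀ j ∈ Finset.univ.piAntidiag d, j ≠ (fun k => (z k).1) →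
      coeff z (tensorProd a (fun k => j k + 1) (fun k => ∑ l ∈ Finset.Iio k, j l) x x) = 0 := by
    intro j hj hne
    obtain ⟨ι, _, u, w, h1, h2⟩ := coeff_tensorProd j (fun k => ∑ l ∈ Finset.Iio k, j l) z
    rw [h2]
    refine Finset.sum_eq_zero fun t _ => ?_
    by_contra h
    -- The `j_k` and the dimensions of `v` both add up to `d`, so the termwise inequalities are
    -- equalities.
    have eq_of : ∀ v : Cell a, coeff v x ≠ 0 → (∀ k, j k ≤ (v k).1) → ∀ k, j k = (v k).1 := by
      intro v hv hle k
      refine (Finset.sum_eq_sum_iff_of_le fun k _ => hle k).1 ?_ k (Finset.mem_univ k)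
      rw [(Finset.mem_piAntidiag.1 hj).1]
      exact_mod_cast (hx v hv).symm
    refine hne (funext fun k => ?_)
    have hu := eq_of (u t) (left_ne_zero_of_mul h) (fun k => (h1 t k).le_left) k
    have hw := eq_of (w t) (right_ne_zero_of_mul h) (fun k => (h1 t k).le_right) k
    have := (h1 t k).dim_add
    omega
  rw [localCup_apply, map_sum]
  by_cases hz : ∑ k, (z k).1 = d
  · rw [Finset.sum_eq_single (fun k => (z k).1) h0 fun h => absurd (by simp [hz]) h,
      coeff_tensorProd_top]
    -- The two elements of `𝔽₂` are idempotent.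
    generalize coeff z x = r
    fin_cases r <;> rfl
  · rw [Finset.sum_eq_zero fun j hj => h0 j hj ?_]
    · by_contra h
      exact hz (by exact_mod_cast hx z (Ne.symm h))
    · rintro rfl
      exact hz (Finset.mem_piAntidiag.1 hj).1

end Local

/-! ### Cup-`i` products of global sections -/

section Global

variable {n : ℕ} {K K' : FilteredFaceSet.{u} n}

/-- The cup-`i` product of global sections, computed simplexwise, as a function. -/
noncomputable def sectionCupFun (i : ℕ) (x y : GlobalSection K) : GlobalSection K :=
  ⟨fun a σ => localCup a.1 i (x.val a σ) (y.val a σ), fun a b f σ => by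
    beta_reduce
    rw [x.val_map f, y.val_map f, pullback_localCup]⟩

theorem sectionCupFun_val (i : ℕ) (x y : GlobalSection K) (a : RegularSimplex n)
    (σ : K.obj (op a.1)) :
    (sectionCupFun i x y).val a σ = localCup a.1 i (x.val a σ) (y.val a σ) :=
  rfl

/-- The cup-`i` product of global sections, computed simplexwise. -/
noncomputable def sectionCup (K : FilteredFaceSet.{u} n) (i : ℕ) :
    GlobalSection K →ₗ[ZMod 2] GlobalSection K →ₗ[ZMod 2] GlobalSection K :=
  LinearMap.mk₂ (ZMod 2) (sectionCupFun i)
    (fun x x' y => GlobalSection.ext fun a σ => by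
      simp only [map_add, sectionCupFun_val, LinearMap.add_apply])
    (fun r x y => GlobalSection.ext fun a σ => by
      simp only [map_smul, sectionCupFun_val, LinearMap.smul_apply])
    (fun x y y' => GlobalSection.ext fun a σ => by
      simp only [map_add, sectionCupFun_val])
    (fun r x y => GlobalSection.ext fun a σ => by
      simp only [map_smul, sectionCupFun_val])

theorem sectionδ_sectionCup_zero (x y : GlobalSection K) :
    sectionδ K (sectionCup K 0 x y) =
      sectionCup K 0 (sectionδ K x) y + sectionCup K 0 x (sectionδ K y) :=
  GlobalSection.ext fun a σ => by
    rw [map_add]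
    exact localδ_localCup_zero _ _

theorem sectionδ_sectionCup_succ (i : ℕ) (x y : GlobalSection K) :
    sectionδ K (sectionCup K (i + 1) x y) = sectionCup K i x y + sectionCup K i y x +
      sectionCup K (i + 1) (sectionδ K x) y + sectionCup K (i + 1) x (sectionδ K y) :=
  GlobalSection.ext fun a σ => by
    rw [map_add, map_add, map_add]
    exact localδ_localCup_succ i _ _

/-- An integer form of admissibility. The value `-∞` needs no separate case, since it is a supremum
over no cells. -/
theorem isAdmissible_iff_int (p : LoosePerversity) (c : GlobalSection K) : IsAdmissible p c ↔
    ∀ ℓ : ℕ, 1 ≤ ℓ → ℓ ≤ n → ∀ (a : RegularSimplex n) (σ : K.obj (op a.1)) (i : Fin (n + 1)),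
      (i : ℕ) + ℓ = n → ∀ y : Cell a.1, (∀ v ∈ vertices (y i), v.1 ≠ ⊤) →
      coeff y (c.val a σ) ≠ 0 → ∑ j ∈ Finset.Ioi i, ((y j).1 : ℤ) ≤ p.1 ℓ := by
  rw [isAdmissible_iff]
  simp only [vertices, Set.forall_mem_range]
  have h : ∀ (N : ℕ) (m : ℤ), (N : EReal) ≤ ((m : ℝ) : EReal) ↔ (N : ℤ) ≤ m := by
    intro N m
    rw [show (N : EReal) = ((N : ℝ) : EReal) from rfl, EReal.coe_le_coe_iff]
    exact_mod_cast Iff.rfl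
  simp only [h]
  simp only [Nat.cast_sum]

/-- A cell of the product that avoids the cone point in factor `k` comes from cells of `x` and `y`
that avoid it there, and `dim z_l ≤ dim u_l + dim w_l` in each later factor. -/
theorem IsAdmissible.cup {p q r : LoosePerversity} (hr : p + q = r) {x y : GlobalSection K}
    (hx : IsAdmissible p x) (hy : IsAdmissible q y) (i : ℕ) :
    IsAdmissible r (sectionCup K i x y) := by
  rw [isAdmissible_iff_int] at *
  intro ℓ h1 h2 a σ k hk z hz hc
  obtain ⟨j, u, w, -, h, hu, hw⟩ := exists_of_coeff_localCup_ne_zero hc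
  have hu' := hx ℓ h1 h2 a σ k hk u (fun v hv => hz v ((h k).vertices_left hv)) hu
  have hw' := hy ℓ h1 h2 a σ k hk w (fun v hv => hz v ((h k).vertices_right hv)) hw
  have hpq : r.1 ℓ = p.1 ℓ + q.1 ℓ := by rw [← hr]; rfl
  rw [hpq]
  refine le_trans ?_ (add_le_add hu' hw')
  rw [← Finset.sum_add_distrib]
  refine Finset.sum_le_sum fun l _ => ?_
  have := (h l).dim_add
  omega

/-- Admissibility of the coboundary follows from the coboundary formula: each of its terms is a
product of admissible sections, the lower products `∪_{i-1}` included. -/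
theorem sectionCup_mem {p q r : LoosePerversity} (hr : p + q = r) {i : ℕ} {s t m : ℤ}
    (hm : m + i = s + t) {x y : GlobalSection K} (hx : x ∈ intersectionCochain K p s)
    (hy : y ∈ intersectionCochain K q t) : sectionCup K i x y ∈ intersectionCochain K r m := by
  refine ⟨fun a σ => (hx.1 a σ).localCup hm (hy.1 a σ), hx.2.1.cup hr hy.2.1 i, ?_⟩
  have h1 := hx.2.2.cup hr hy.2.1
  have h2 := hx.2.1.cup hr hy.2.2
  cases i with
  | zero =>
    rw [sectionδ_sectionCup_zero]
    exact (h1 0).add (h2 0)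
  | succ i =>
    rw [sectionδ_sectionCup_succ]
    have hr' : q + p = r := by
      rw [← hr]
      exact Subtype.ext (funext fun ℓ => add_comm _ _)
    exact (((hx.2.1.cup hr hy.2.1 i).add (hy.2.1.cup hr' hx.2.1 i)).add (h1 _)).add (h2 _)

/-! ### The action of the resolution -/

/-- The coefficient of a group element, as a linear form. -/
noncomputable def E2.coeffₗ (g : Equiv.Perm (Fin 2)) : E2 →ₗ[ZMod 2] ZMod 2 :=
  Finsupp.lapply g ∘ₗ (MonoidAlgebra.coeffLinearEquiv (ZMod 2)).toLinearMap

theorem E2.coeffₗ_τ_mul (g : Equiv.Perm (Fin 2)) (b : E2) :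
    coeffₗ g (τ * b) = coeffₗ (Equiv.swap 0 1 * g) b := by
  change (τ * b).coeff g = b.coeff (Equiv.swap 0 1 * g)
  simp [τ]

/-- The differential is multiplication by `1 + τ`, and `τ` permutes the two coefficients. -/
theorem E2.coeffₗ_d (g : Equiv.Perm (Fin 2)) (b : E2) :
    coeffₗ g (d b) = coeffₗ g b + coeffₗ (Equiv.swap 0 1 * g) b := by
  have : d b = b + τ * b := by
    change (e + τ) * b = _
    rw [add_mul, show e = (1 : E2) from rfl, one_mul]
  rw [this, map_add, coeffₗ_τ_mul]

/-- The action of `E(2)_i` on global sections, with `e_i ⊗ x ⊗ y ↦ x ∪_i y`. -/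
noncomputable def sectionψ (K : FilteredFaceSet.{u} n) (i : ℕ) :
    E2 →ₗ[ZMod 2] GlobalSection K →ₗ[ZMod 2] GlobalSection K →ₗ[ZMod 2] GlobalSection K :=
  (E2.coeffₗ 1).smulRight (sectionCup K i) +
    (E2.coeffₗ (Equiv.swap 0 1)).smulRight (sectionCup K i).flip

theorem sectionψ_apply (i : ℕ) (b : E2) (x y : GlobalSection K) :
    sectionψ K i b x y = E2.coeffₗ 1 b • sectionCup K i x y +
      E2.coeffₗ (Equiv.swap 0 1) b • sectionCup K i y x :=
  rfl

theorem sectionψ_e (i : ℕ) (x y : GlobalSection K) :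
    sectionψ K i E2.e x y = sectionCup K i x y := by
  have h1 : E2.coeffₗ 1 E2.e = 1 := by
    change (MonoidAlgebra.single 1 1 : E2).coeff 1 = 1
    simp
  have h2 : E2.coeffₗ (Equiv.swap 0 1) E2.e = 0 := by
    change (MonoidAlgebra.single 1 1 : E2).coeff (Equiv.swap 0 1) = 0
    rw [MonoidAlgebra.coeff_single, Finsupp.single_apply, if_neg (by decide)]
  rw [sectionψ_apply, h1, h2, one_smul, zero_smul, add_zero]

theorem sectionψ_τ_mul (i : ℕ) (b : E2) (x y : GlobalSection K) :
    sectionψ K i (E2.τ * b) x y = sectionψ K i b y x := by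
  rw [sectionψ_apply, sectionψ_apply, E2.coeffₗ_τ_mul, E2.coeffₗ_τ_mul, mul_one,
    Equiv.swap_mul_self, add_comm]

theorem sectionMap_sectionψ (f : K ⟶ K') (i : ℕ) (b : E2) (x y : GlobalSection K') :
    sectionMap f (sectionψ K' i b x y) = sectionψ K i b (sectionMap f x) (sectionMap f y) :=
  rfl

theorem sectionδ_sectionψ_zero (b : E2) (x y : GlobalSection K) :
    sectionδ K (sectionψ K 0 b x y) =
      sectionψ K 0 b (sectionδ K x) y + sectionψ K 0 b x (sectionδ K y) := by
  simp only [sectionψ_apply, map_add, map_smul, sectionδ_sectionCup_zero, smul_add]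
  abel

theorem sectionδ_sectionψ_succ (i : ℕ) (b : E2) (x y : GlobalSection K) :
    sectionδ K (sectionψ K (i + 1) b x y) = sectionψ K i (E2.d b) x y +
      sectionψ K (i + 1) b (sectionδ K x) y + sectionψ K (i + 1) b x (sectionδ K y) := by
  simp only [sectionψ_apply, map_add, map_smul, sectionδ_sectionCup_succ, smul_add, E2.coeffₗ_d,
    mul_one, Equiv.swap_mul_self, add_smul]
  abel

theorem sectionψ_mem {p q r : LoosePerversity} (hr : p + q = r) {i : ℕ} {s t m : ℤ}
    (hm : m + i = s + t) (b : E2) {x y : GlobalSection K} (hx : x ∈ intersectionCochain K p s)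
    (hy : y ∈ intersectionCochain K q t) : sectionψ K i b x y ∈ intersectionCochain K r m := by
  have hr' : q + p = r := by
    rw [← hr]
    exact Subtype.ext (funext fun ℓ => add_comm _ _)
  exact add_mem (Submodule.smul_mem _ _ (sectionCup_mem hr hm hx hy))
    (Submodule.smul_mem _ _ (sectionCup_mem hr' (hm.trans (add_comm s t)) hy hx))

/-- The action of `E(2)_i` on intersection cochains. -/
noncomputable def intersectionψ (K : FilteredFaceSet.{u} n) {p q r : LoosePerversity}
    (hr : p + q = r) (i : ℕ) {s t m : ℤ} (hm : m + i = s + t) :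
    E2 →ₗ[ZMod 2] intersectionCochain K p s →ₗ[ZMod 2] intersectionCochain K q t →ₗ[ZMod 2]
      intersectionCochain K r m where
  toFun b := LinearMap.mk₂ (ZMod 2)
    (fun x y => ⟨sectionψ K i b x.1 y.1, sectionψ_mem hr hm b x.2 y.2⟩)
    (fun _ _ _ => Subtype.ext (LinearMap.map_add₂ (sectionψ K i b) _ _ _))
    (fun _ _ _ => Subtype.ext (LinearMap.map_smul₂ (sectionψ K i b) _ _ _))
    (fun x _ _ => Subtype.ext (map_add (sectionψ K i b x.1) _ _))
    (fun _ x _ => Subtype.ext (map_smul (sectionψ K i b x.1) _ _))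
  map_add' b b' := LinearMap.ext fun x => LinearMap.ext fun y => Subtype.ext
    (LinearMap.congr_fun (LinearMap.congr_fun (map_add (sectionψ K i) b b') x.1) y.1)
  map_smul' c b := LinearMap.ext fun x => LinearMap.ext fun y => Subtype.ext
    (LinearMap.congr_fun (LinearMap.congr_fun (map_smul (sectionψ K i) c b) x.1) y.1)

/-- The differential of the complex is defined by cases on `d + 1 = e`; this selects the nonzero
case. -/
theorem blowup_d_apply (K : FilteredFaceSet.{u} n) (p : LoosePerversity) {d e : ℤ} (h : d + 1 = e)
    (x : intersectionCochain K p d) :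
    (((blowup K).obj p).d d e x : intersectionCochain K p e) = intersectionδ K p h x := by
  simp only [blowup, intersectionComplex, dif_pos h]
  rfl

theorem intersectionδ_intersectionψ_zero {p q r : LoosePerversity} (hr : p + q = r)
    {s t m s' t' m' : ℤ} (hs : s + 1 = s') (ht : t + 1 = t') (hm' : m + 1 = m')
    (hm : m + (0 : ℕ) = s + t) (b : E2) (x : intersectionCochain K p s)
    (y : intersectionCochain K q t) :
    intersectionδ K r hm' (intersectionψ K hr 0 hm b x y) =
      intersectionψ K hr 0 (by omega) b (intersectionδ K p hs x) y +
        intersectionψ K hr 0 (by omega) b x (intersectionδ K q ht y) :=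
  Subtype.ext (sectionδ_sectionψ_zero b x.1 y.1)

theorem intersectionδ_intersectionψ_succ {p q r : LoosePerversity} (hr : p + q = r) (i : ℕ)
    {s t m s' t' m' : ℤ} (hs : s + 1 = s') (ht : t + 1 = t') (hm' : m + 1 = m')
    (hm : m + (i + 1 : ℕ) = s + t) (b : E2) (x : intersectionCochain K p s)
    (y : intersectionCochain K q t) :
    intersectionδ K r hm' (intersectionψ K hr (i + 1) hm b x y) =
      intersectionψ K hr i (by omega) (E2.d b) x y +
        intersectionψ K hr (i + 1) (by omega) b (intersectionδ K p hs x) y +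
          intersectionψ K hr (i + 1) (by omega) b x (intersectionδ K q ht y) :=
  Subtype.ext (sectionδ_sectionψ_succ i b x.1 y.1)

/-- The structure of perverse `E(2)`-algebra on the blow-up of a filtered face set. -/
noncomputable def blowupAlgebra (K : FilteredFaceSet.{u} n) : PerverseE2Algebra (blowup K) where
  ψ hr i _ _ _ hm := intersectionψ K hr i hm
  natural := by
    intros
    rfl
  equivariant _ _ i _ _ _ _ _ b x y := Subtype.ext (sectionψ_τ_mul i b x.1 y.1)
  d_zero {p q r} hr s t m s' t' m' hs ht hm' hm b x y := by
    have h := intersectionδ_intersectionψ_zero hr hs ht hm' hm b x y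
    -- The identity is known for `intersectionδ`; the differentials of the complex are exchanged for
    -- it in the result and in both arguments.
    exact (blowup_d_apply K r hm' _).trans (h.trans (congrArg₂
      (fun (x' : intersectionCochain K p s') (y' : intersectionCochain K q t') =>
        intersectionψ K hr 0 (by omega : m' + (0 : ℕ) = s' + t) b x' y +
          intersectionψ K hr 0 (by omega : m' + (0 : ℕ) = s + t') b x y')
      (blowup_d_apply K p hs x).symm (blowup_d_apply K q ht y).symm))
  d_succ {p q r} hr i s t m s' t' m' hs ht hm' hm b x y := by
    have h := intersectionδ_intersectionψ_succ hr i hs ht hm' hm b x y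
    exact (blowup_d_apply K r hm' _).trans (h.trans (congrArg₂
      (fun (x' : intersectionCochain K p s') (y' : intersectionCochain K q t') =>
        intersectionψ K hr i (by omega : m' + i = s + t) (E2.d b) x y +
          intersectionψ K hr (i + 1) (by omega : m' + (i + 1 : ℕ) = s' + t) b x' y +
          intersectionψ K hr (i + 1) (by omega : m' + (i + 1 : ℕ) = s + t') b x y')
      (blowup_d_apply K p hs x).symm (blowup_d_apply K q ht y).symm))

theorem blowupAlgebra_isNice (K : FilteredFaceSet.{u} n) : (blowupAlgebra K).IsNice where
  cup_self _ _ d x := Subtype.ext <| (sectionψ_e d x.1 x.1).trans <|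
    GlobalSection.ext fun a σ => localCup_self (x.2.1 a σ)
  cup_eq_zero _ i _ _ _ _ hi x y := Subtype.ext <| (sectionψ_e i x.1 y.1).trans <|
    GlobalSection.ext fun a σ => localCup_eq_zero hi (x.2.1 a σ) (y.2.1 a σ)

end Global

end PerverseBlowup

theorem mainTheorem2 (n : ℕ) :
    ∃ S : ∀ K : PerverseBlowup.FilteredFaceSet.{u} n,
        PerverseBlowup.PerverseE2Algebra (PerverseBlowup.blowup K),
      (∀ K : PerverseBlowup.FilteredFaceSet.{u} n, (S K).IsNice) ∧
      ∀ (K K' : PerverseBlowup.FilteredFaceSet.{u} n) (f : K ⟶ K')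
        (p q r : PerverseBlowup.LoosePerversity) (hr : p + q = r) (i : ℕ) (s t m : ℤ)
        (hm : m + i = s + t) (b : PerverseBlowup.E2)
        (x : ((PerverseBlowup.blowup K').obj p).X s)
        (y : ((PerverseBlowup.blowup K').obj q).X t),
        ((PerverseBlowup.blowupMap f).app r).f m ((S K').ψ hr i hm b x y) =
          (S K).ψ hr i hm b (((PerverseBlowup.blowupMap f).app p).f s x)
            (((PerverseBlowup.blowupMap f).app q).f t y) :=
  ⟨PerverseBlowup.blowupAlgebra, PerverseBlowup.blowupAlgebra_isNice,
    fun _ _ f _ _ _ _ i _ _ _ _ b x y =>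
      Subtype.ext (PerverseBlowup.sectionMap_sectionψ f i b x.1 y.1)⟩
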